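/- A $3$-graph on $n$ vertices is a set $\mathcal{H}$ of $3$-element subsets (edges) of an $n$-element vertex set. A family $\mathcal{F}$ of edges is non-trivial intersecting if every two edges of $\mathcal{F}$ have a nonempty intersection but no vertex is contained in all edges of $\mathcal{F}$. A Steiner $(n,3,t)$-system is a $3$-graph on $n$ vertices in which every pair of distinct vertices is contained in exactly $t$ edges. The complement $\overline{\mathcal{S}}$ of a $3$-graph $\mathcal{S}$ consists of all triples of vertices that are not edges of $\mathcal{S}$. A perfect matching is a set of pairwise disjoint triples covering all vertices. Theorem. Let $m\ge 4$ be an integer. (1) There is $N=N(m)$ such that for every multiple $n\ge N$ of $3$ there exists a $3$-graph on $n$ vertices with exactly $\frac{m-1}{3}\binom n2+\frac n3$ edges that contains no non-trivial intersecting subgraph of size $3m+1$. Moreover, for every such $n$, if $m$ or $n$ is odd, then there exist a Steiner $(n,3,m-1)$-system $\mathcal{S}$ and a perfect matching $\mathcal{M}\subseteq\overline{\mathcal{S}}$. (2) For every $n$, every Steiner $(n,3,m-1)$-system $\mathcal{S}$ on $n$ vertices and every perfect matching $\mathcal{M}\subseteq\overline{\mathcal{S}}$, the $3$-graph $\mathcal{S}\cup\mathcal{M}$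 has exactly $\frac{m-1}{3}\binom n2+\frac n3$ edges and contains no non-trivial intersecting subgraph of size $3m+1$. (3) Consequently the following conjecture of Mubayi and Verstraëte fails for every $m\ge 4$: for all sufficiently large $n$, every $3$-graph $\mathcal{H}$ on $n$ vertices that contains no non-trivial intersecting subgraph of size $3m+1$ satisfies $|\mathcal{H}|\le\frac{m-1}{3}\binom n2$, with equality if and only if $\mathcal{H}$ is a Steiner $(n,3,m-1)$-system. -/

import Mathlib

/-- A `3`-graph on the vertex set `Fin n`: a set of edges, all of which have exactly three vertices. -/
def IsThreeGraph {n : ℕ} (H : Finset (Finset (Fin n))) : Prop :=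
  ∀ E ∈ H, E.card = 3

/-- A hypergraph is non-trivial intersecting if any two of its edges meet, but no vertex lies in
all of its edges. -/
def IsNontrivialIntersecting {n : ℕ} (F : Finset (Finset (Fin n))) : Prop :=
  (∀ A ∈ F, ∀ B ∈ F, (A ∩ B).Nonempty) ∧ ¬ ∃ v : Fin n, ∀ E ∈ F, v ∈ E

/-- `H` contains no non-trivial intersecting subgraph with exactly `s` edges. -/
def NoNontrivialIntersectingSubgraph {n : ℕ} (H : Finset (Finset (Fin n))) (s : ℕ) : Prop :=
  ∀ F : Finset (Finset (Fin n)), F ⊆ H → F.card = s → ¬ IsNontrivialIntersecting F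

/-- The number of edges of `H` that contain both `u` and `v`. -/
def pairDegree {n : ℕ} (H : Finset (Finset (Fin n))) (u v : Fin n) : ℕ :=
  (H.filter fun E => u ∈ E ∧ v ∈ E).card

/-- A Steiner `(n, 3, t)`-system: a `3`-graph on `n` vertices such that every pair of distinct
vertices is contained in exactly `t` edges. -/
def IsSteinerTripleSystem {n : ℕ} (S : Finset (Finset (Fin n))) (t : ℕ) : Prop :=
  IsThreeGraph S ∧ ∀ u v : Fin n, u ≠ v → pairDegree S u v = t

/-- A perfect matching of triples: pairwise disjoint triples that cover all vertices. -/
def IsPerfectTripleMatching {n : ℕ} (M : Finset (Finset (Fin n))) : Prop :=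
  IsThreeGraph M ∧ (∀ A ∈ M, ∀ B ∈ M, A ≠ B → Disjoint A B) ∧ ∀ v : Fin n, ∃ E ∈ M, v ∈ E

/-- The complement of a `3`-graph: all triples of vertices that are not edges. -/
def tripleComplement {n : ℕ} (H : Finset (Finset (Fin n))) : Finset (Finset (Fin n)) :=
  Finset.powersetCard 3 Finset.univ \ H

/-- The conjecture of Mubayi and Verstraëte on `3`-graphs, for a given `m`: for all sufficiently
large `n`, every `3`-graph on `n` vertices without a non-trivial intersecting subgraph of size
`3 m + 1` has at most `(m - 1) / 3 * (n choose 2)` edges, with equality if and only if it is a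
Steiner `(n, 3, m - 1)`-system. -/
def MubayiVerstraeteConjecture (m : ℕ) : Prop :=
  ∃ N : ℕ, ∀ n : ℕ, N ≤ n → ∀ H : Finset (Finset (Fin n)),
    IsThreeGraph H → NoNontrivialIntersectingSubgraph H (3 * m + 1) →
      (H.card : ℚ) ≤ ((m : ℚ) - 1) / 3 * (n.choose 2 : ℚ) ∧
      ((H.card : ℚ) = ((m : ℚ) - 1) / 3 * (n.choose 2 : ℚ) ↔ IsSteinerTripleSystem H (m - 1))

/-! ### Sizes of intersecting families of triples -/

section Intersecting
open Finset

variable {α : Type*} [DecidableEq α]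

/-! Everything rests on the criterion `noNontrivialIntersectingSubgraph_of_pairDegree`. An
intersecting family of triples with no two-vertex cover has at most 12 < 3m + 1 members
(`card_le_twelve`). If {x, y} is a cover, at most m edges contain both vertices, and the links of x
and y on the other edges are cross-intersecting graphs; when both have at least two edges, they have
at most 2m together (`card_le_of_cover_pair`). Otherwise, up to swapping x and y, the family is a
star at x plus one edge E₀ avoiding x. Three pair degrees bound the star by 3m, and the second
hypothesis saves one: some degree is below m, or an edge is counted twice.

In S ∪ M the pairs of degree m are those inside matching edges, so each vertex lies in only two of
them and the criterion applies. Pair degrees over ordered pairs sum to 6 |H|, which gives the edge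
count.

Existence uses a Bose-type construction on three copies of ℤ/q, with an index set `D` of shifts and
bits. Mixed edges solve x + y + shift = 2z up to a bit correction. Every pair gets `#D` solutions,
but between consecutive levels the degenerate solution y = x may be lost; transversal edges repair
exactly that loss. A shift left unused supplies the perfect matching. For q even, bits double the
number of indices, so only even m - 1 arises. If m and n are both even, one index is dropped from
`D` while the transversal edges stay: n pairs then have degree m, and whenever three of them share a
vertex some edge contains two of them, so the criterion still applies. The conjectured bound is
exceeded by n/3. -/

theorem card_le_sum_card_filter_mem {G : Finset (Finset α)} {T : Finset α}
    (h : ∀ E ∈ G, ∃ t ∈ T, t ∈ E) : #G ≤ ∑ t ∈ T, #{E ∈ G | t ∈ E} := by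
  refine le_trans (card_le_card ?_) card_biUnion_le
  intro E hE
  obtain ⟨t, ht, htE⟩ := h E hE
  exact mem_biUnion.2 ⟨t, ht, mem_filter.2 ⟨hE, htE⟩⟩

theorem eq_triple_of_mem {E : Finset α} (hE : #E = 3) {x y z : α} (hxy : x ≠ y) (hxz : x ≠ z)
    (hyz : y ≠ z) (hx : x ∈ E) (hy : y ∈ E) (hz : z ∈ E) : E = {x, y, z} := by
  refine (eq_of_subset_of_card_le ?_ ?_).symm
  · intro a; simp only [mem_insert, mem_singleton]; rintro (rfl | rfl | rfl) <;> assumption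
  · rw [hE, card_eq_three.2 ⟨x, y, z, hxy, hxz, hyz, rfl⟩]

theorem card_le_one_of_three_mem {G : Finset (Finset α)} (hG : ∀ E ∈ G, #E = 3) {x y z : α}
    (hxy : x ≠ y) (hxz : x ≠ z) (hyz : y ≠ z) (h : ∀ E ∈ G, x ∈ E ∧ y ∈ E ∧ z ∈ E) :
    #G ≤ 1 := by
  refine card_le_one.2 fun E hE E' hE' => ?_
  rw [eq_triple_of_mem (hG E hE) hxy hxz hyz (h E hE).1 (h E hE).2.1 (h E hE).2.2,
    eq_triple_of_mem (hG E' hE') hxy hxz hyz (h E' hE').1 (h E' hE').2.1 (h E' hE').2.2]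

/-- Edges through two fixed vertices that all meet a set `T` number at most `#T`. -/
theorem card_le_of_pair_mem {G : Finset (Finset α)} (hG : ∀ E ∈ G, #E = 3) {x y : α} {T : Finset α}
    (hxy : x ≠ y) (hx : x ∉ T) (hy : y ∉ T) (h : ∀ E ∈ G, x ∈ E ∧ y ∈ E)
    (hT : ∀ E ∈ G, ∃ t ∈ T, t ∈ E) : #G ≤ #T := by
  refine (card_le_sum_card_filter_mem hT).trans ?_
  rw [card_eq_sum_ones]
  refine sum_le_sum fun t ht => ?_
  refine card_le_one_of_three_mem (x := x) (y := y) (z := t) ?_ hxy ?_ ?_ ?_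
  · intro E hE; exact hG E (mem_filter.1 hE).1
  · rintro rfl; exact hx ht
  · rintro rfl; exact hy ht
  · intro E hE
    rw [mem_filter] at hE
    exact ⟨(h E hE.1).1, (h E hE.1).2, hE.2⟩

/-- The edges that contain `x` but not `y`. -/
def edgesAvoiding (F : Finset (Finset α)) (x y : α) : Finset (Finset α) :=
  {E ∈ F | x ∈ E ∧ y ∉ E}

theorem mem_edgesAvoiding {F : Finset (Finset α)} {x y : α} {E : Finset α} :
    E ∈ edgesAvoiding F x y ↔ E ∈ F ∧ x ∈ E ∧ y ∉ E := by
  simp [edgesAvoiding]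

variable {F : Finset (Finset α)}

theorem exists_mem_erase (hint : ∀ A ∈ F, ∀ B ∈ F, (A ∩ B).Nonempty) {x y : α} {E E' : Finset α}
    (hE : E ∈ edgesAvoiding F x y) (hE' : E' ∈ F) : ∃ t ∈ E'.erase y, t ∈ E := by
  rw [mem_edgesAvoiding] at hE
  obtain ⟨t, ht⟩ := hint E hE.1 E' hE'
  rw [mem_inter] at ht
  refine ⟨t, mem_erase.2 ⟨?_, ht.2⟩, ht.1⟩
  rintro rfl; exact hE.2.2 ht.1

/-- An edge through x and w that misses y is fixed by which of the two vertices of E' \ {y} it hits.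
The contrapositive `mem_of_three_le` is the main tool: a vertex of degree three in the link of x
lies in every edge on the y side. -/
theorem card_edgesAvoiding_filter_le_two (h3 : ∀ E ∈ F, #E = 3)
    (hint : ∀ A ∈ F, ∀ B ∈ F, (A ∩ B).Nonempty) {x y w : α} (hwx : w ≠ x) {E' : Finset α}
    (hE' : E' ∈ edgesAvoiding F y x) (hw : w ∉ E') : #{E ∈ edgesAvoiding F x y | w ∈ E} ≤ 2 := by
  have hE'' := mem_edgesAvoiding.1 hE'
  have hc : #(E'.erase y) = 2 := by rw [card_erase_of_mem hE''.2.1, h3 _ hE''.1]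
  rw [← hc]
  refine card_le_of_pair_mem (x := x) (y := w) ?_ hwx.symm ?_ ?_ ?_ ?_
  · intro E hE; exact h3 E (mem_edgesAvoiding.1 (mem_filter.1 hE).1).1
  · intro h; exact hE''.2.2 (mem_of_mem_erase h)
  · intro h; exact hw (mem_of_mem_erase h)
  · intro E hE
    rw [mem_filter, mem_edgesAvoiding] at hE
    exact ⟨hE.1.2.1, hE.2⟩
  · intro E hE; exact exists_mem_erase hint (mem_filter.1 hE).1 hE''.1

theorem mem_of_three_le (h3 : ∀ E ∈ F, #E = 3)
    (hint : ∀ A ∈ F, ∀ B ∈ F, (A ∩ B).Nonempty) {x y w : α} (hwx : w ≠ x)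
    (hd : 3 ≤ #{E ∈ edgesAvoiding F x y | w ∈ E}) {E' : Finset α}
    (hE' : E' ∈ edgesAvoiding F y x) : w ∈ E' := by
  by_contra hw
  have := card_edgesAvoiding_filter_le_two h3 hint hwx hE' hw
  omega

/-- A bound on the number of edges through `x` and not `y`, from an edge through `y` and not `x`. -/
theorem card_edgesAvoiding_le (h3 : ∀ E ∈ F, #E = 3)
    (hint : ∀ A ∈ F, ∀ B ∈ F, (A ∩ B).Nonempty) {x y : α} {E' : Finset α}
    (hE' : E' ∈ edgesAvoiding F y x) {c : ℕ}
    (hc : ∀ w ∈ E', w ≠ x → w ≠ y → #{E ∈ edgesAvoiding F x y | w ∈ E} ≤ c) :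
    #(edgesAvoiding F x y) ≤ 2 * c := by
  have hE'' := mem_edgesAvoiding.1 hE'
  have hcard : #(E'.erase y) = 2 := by rw [card_erase_of_mem hE''.2.1, h3 _ hE''.1]
  refine (card_le_sum_card_filter_mem (T := E'.erase y)
    fun E hE => exists_mem_erase hint hE hE''.1).trans ?_
  rw [← hcard, ← smul_eq_mul]
  refine sum_le_card_nsmul _ _ _ fun w hw => ?_
  rw [mem_erase] at hw
  refine hc w hw.2 ?_ hw.1
  rintro rfl; exact hE''.2.2 hw.2

/-- Since E' = {y, w, t}, every edge on the x side contains w or t. -/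
theorem card_edgesAvoiding_le_add (h3 : ∀ E ∈ F, #E = 3)
    (hint : ∀ A ∈ F, ∀ B ∈ F, (A ∩ B).Nonempty) {x y w : α} {E' : Finset α}
    (hE' : E' ∈ edgesAvoiding F y x) (hw : w ∈ E') (hwy : w ≠ y) :
    ∃ t ∈ E', t ≠ x ∧ t ≠ y ∧ t ≠ w ∧ #(edgesAvoiding F x y) ≤
      #{E ∈ edgesAvoiding F x y | w ∈ E} + #{E ∈ edgesAvoiding F x y | t ∈ E} := by
  have hE'' := mem_edgesAvoiding.1 hE'
  have hcard : #((E'.erase y).erase w) = 1 := by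
    rw [card_erase_of_mem (mem_erase.2 ⟨hwy, hw⟩), card_erase_of_mem hE''.2.1, h3 _ hE''.1]
  obtain ⟨t, ht⟩ := card_eq_one.1 hcard
  have htm : t ∈ (E'.erase y).erase w := by rw [ht]; exact mem_singleton_self t
  simp only [mem_erase] at htm
  refine ⟨t, htm.2.2, ?_, htm.2.1, htm.1, ?_⟩
  · rintro rfl; exact hE''.2.2 htm.2.2
  · refine (card_le_sum_card_filter_mem (T := E'.erase y)
      fun E hE => exists_mem_erase hint hE hE''.1).trans ?_
    rw [← insert_erase (mem_erase.2 ⟨hwy, hw⟩ : w ∈ E'.erase y), ht,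
      sum_insert (by simpa using htm.1.symm), sum_singleton]

theorem card_eq_add_edgesAvoiding (F : Finset (Finset α)) (x y : α) :
    #F = #{E ∈ F | x ∈ E ∧ y ∈ E} + #(edgesAvoiding F x y) + #(edgesAvoiding F y x) +
      #{E ∈ F | x ∉ E ∧ y ∉ E} := by
  rw [← card_filter_add_card_filter_not (s := F) (fun E => x ∈ E),
    ← card_filter_add_card_filter_not (s := {E ∈ F | x ∈ E}) (fun E => y ∈ E),
    ← card_filter_add_card_filter_not (s := {E ∈ F | x ∉ E}) (fun E => y ∈ E)]
  simp only [filter_filter, edgesAvoiding]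
  rw [filter_congr (p := fun E => y ∈ E ∧ x ∉ E) (q := fun E => x ∉ E ∧ y ∈ E)
    fun _ _ => and_comm]
  ring

theorem card_le_of_card_edgesAvoiding_le_one {m : ℕ}
    (hint : ∀ A ∈ F, ∀ B ∈ F, (A ∩ B).Nonempty) (hno : ∀ v, ∃ E ∈ F, v ∉ E)
    (hstar : ∀ x E₀, E₀ ∈ F → x ∉ E₀ → #{E ∈ F | x ∈ E ∧ ∃ t ∈ E₀, t ∈ E} + 1 ≤ 3 * m)
    {x y : α} (hcov : ∀ E ∈ F, x ∈ E ∨ y ∈ E) (h1 : #(edgesAvoiding F y x) ≤ 1) :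
    #F ≤ 3 * m := by
  obtain ⟨E₀, hE₀, hx⟩ := hno x
  have hmem : E₀ ∈ edgesAvoiding F y x :=
    mem_edgesAvoiding.2 ⟨hE₀, (hcov E₀ hE₀).resolve_left hx, hx⟩
  refine le_trans ?_ (hstar x E₀ hE₀ hx)
  refine le_trans (card_le_card (t := insert E₀ {E ∈ F | x ∈ E ∧ ∃ t ∈ E₀, t ∈ E}) ?_)
    (card_insert_le _ _)
  intro E hE
  rw [mem_insert, mem_filter]
  by_cases hxE : x ∈ E
  · obtain ⟨t, ht⟩ := hint E hE E₀ hE₀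
    rw [mem_inter] at ht
    exact Or.inr ⟨hE, hxE, t, ht.2, ht.1⟩
  · exact Or.inl (card_le_one.1 h1 E
      (mem_edgesAvoiding.2 ⟨hE, (hcov E hE).resolve_left hxE, hxE⟩) E₀ hmem)

/-- All edges on the y side contain w, so there are at most m. Three of them force w into the whole
x side, giving m + m. With exactly two, the x side has at most m + 2 edges, and m + 4 ≤ 2m. -/
theorem card_edgesAvoiding_add_le_of_three_le {m : ℕ} (hm : 4 ≤ m) (h3 : ∀ E ∈ F, #E = 3)
    (hint : ∀ A ∈ F, ∀ B ∈ F, (A ∩ B).Nonempty)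
    (hpair : ∀ u v, u ≠ v → #{E ∈ F | u ∈ E ∧ v ∈ E} ≤ m)
    {x y w : α} (hwx : w ≠ x) (hwy : w ≠ y)
    (hw : 3 ≤ #{E ∈ edgesAvoiding F x y | w ∈ E}) (h2 : 2 ≤ #(edgesAvoiding F y x)) :
    #(edgesAvoiding F x y) + #(edgesAvoiding F y x) ≤ 2 * m := by
  have hdeg : ∀ u v, w ≠ u → #{E ∈ edgesAvoiding F u v | w ∈ E} ≤ m := by
    intro u v hu
    refine (card_le_card ?_).trans (hpair u w hu.symm)
    intro E hE
    simp only [mem_filter, mem_edgesAvoiding] at hE ⊢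
    exact ⟨hE.1.1, hE.1.2.1, hE.2⟩
  have hall : ∀ E' ∈ edgesAvoiding F y x, w ∈ E' := fun E' h => mem_of_three_le h3 hint hwx hw h
  have hy : #(edgesAvoiding F y x) ≤ m := by
    rw [← filter_true_of_mem hall]; exact hdeg y x hwy
  rcases lt_or_ge (#(edgesAvoiding F y x)) 3 with hlt | hge
  · obtain ⟨E', hE'⟩ := card_pos.1 (show 0 < #(edgesAvoiding F y x) by omega)
    obtain ⟨t, htE, htx, hty, htw, hle⟩ := card_edgesAvoiding_le_add h3 hint hE' (hall E' hE') hwy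
    -- Were this degree three, every edge on the y side would be {y, w, t}.
    have ht : #{E ∈ edgesAvoiding F x y | t ∈ E} ≤ 2 := by
      by_contra hcon
      have := card_le_one_of_three_mem (G := edgesAvoiding F y x) (x := y) (y := w) (z := t)
        (fun E hE => h3 E (mem_edgesAvoiding.1 hE).1) hwy.symm hty.symm htw.symm
        (fun E hE => ⟨(mem_edgesAvoiding.1 hE).2.1, hall E hE,
          mem_of_three_le h3 hint htx (by omega) hE⟩)
      omega
    have := hdeg x y hwx
    omega
  · have hall' : ∀ E' ∈ edgesAvoiding F x y, w ∈ E' := fun E' h =>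
      mem_of_three_le h3 hint hwy (by rwa [filter_true_of_mem hall]) h
    have hx : #(edgesAvoiding F x y) ≤ m := by
      rw [← filter_true_of_mem hall']; exact hdeg x y hwx
    omega

/-- Intersecting triples with a cover of size two. -/
theorem card_le_of_cover_pair {m : ℕ} (hm : 4 ≤ m) (h3 : ∀ E ∈ F, #E = 3)
    (hint : ∀ A ∈ F, ∀ B ∈ F, (A ∩ B).Nonempty) (hno : ∀ v, ∃ E ∈ F, v ∉ E)
    (hpair : ∀ u v, u ≠ v → #{E ∈ F | u ∈ E ∧ v ∈ E} ≤ m)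
    (hstar : ∀ x E₀, E₀ ∈ F → x ∉ E₀ → #{E ∈ F | x ∈ E ∧ ∃ t ∈ E₀, t ∈ E} + 1 ≤ 3 * m)
    {x y : α} (hxy : x ≠ y) (hcov : ∀ E ∈ F, x ∈ E ∨ y ∈ E) : #F ≤ 3 * m := by
  by_cases hy1 : #(edgesAvoiding F y x) ≤ 1
  · exact card_le_of_card_edgesAvoiding_le_one hint hno hstar hcov hy1
  by_cases hx1 : #(edgesAvoiding F x y) ≤ 1
  · exact card_le_of_card_edgesAvoiding_le_one hint hno hstar
      (fun E hE => (hcov E hE).symm) hx1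
  have hnone : #{E ∈ F | x ∉ E ∧ y ∉ E} = 0 := by
    rw [card_eq_zero, filter_eq_empty_iff]
    intro E hE h
    exact (hcov E hE).elim h.1 h.2
  have hsum := card_eq_add_edgesAvoiding F x y
  have hm' := hpair x y hxy
  suffices #(edgesAvoiding F x y) + #(edgesAvoiding F y x) ≤ 2 * m by omega
  by_cases h : ∃ w, w ≠ x ∧ w ≠ y ∧ 3 ≤ #{E ∈ edgesAvoiding F x y | w ∈ E}
  · obtain ⟨w, hwx, hwy, hw⟩ := h
    exact card_edgesAvoiding_add_le_of_three_le hm h3 hint hpair hwx hwy hw (by omega)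
  by_cases h' : ∃ w, w ≠ x ∧ w ≠ y ∧ 3 ≤ #{E ∈ edgesAvoiding F y x | w ∈ E}
  · obtain ⟨w, hwx, hwy, hw⟩ := h'
    rw [add_comm]
    exact card_edgesAvoiding_add_le_of_three_le hm h3 hint hpair hwy hwx hw (by omega)
  push Not at h h'
  obtain ⟨A, hA⟩ := card_pos.1 (show 0 < #(edgesAvoiding F x y) by omega)
  obtain ⟨B, hB⟩ := card_pos.1 (show 0 < #(edgesAvoiding F y x) by omega)
  -- With all link degrees at most two, each side has at most four edges, and 8 ≤ 2m.
  have h₁ := card_edgesAvoiding_le h3 hint hB (c := 2)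
    fun w _ hwx hwy => Nat.le_of_lt_succ (h w hwx hwy)
  have h₂ := card_edgesAvoiding_le h3 hint hA (c := 2)
    fun w _ hwy hwx => Nat.le_of_lt_succ (h' w hwx hwy)
  omega

/-! ### Intersecting triples that no two vertices cover -/

/-- The bound is 3 + 3 + 2. As w ∉ E₀, meeting E₀ leaves three edges through y, w and three through
x, w; any other edge on the x side contains the third vertex t of an edge {y, w, t}, and t ∈ E₀. -/
theorem card_edgesAvoiding_add_le_eight (h3 : ∀ E ∈ F, #E = 3)
    (hint : ∀ A ∈ F, ∀ B ∈ F, (A ∩ B).Nonempty) {x y w : α} (hwx : w ≠ x)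
    (hwy : w ≠ y) {E₀ : Finset α} (hE₀ : E₀ ∈ F) (hx₀ : x ∉ E₀) (hy₀ : y ∉ E₀)
    (hne : (edgesAvoiding F y x).Nonempty)
    (ht : ∀ t ∈ E₀, #{E ∈ edgesAvoiding F x y | t ∈ E} ≤ 2)
    (hw : 3 ≤ #{E ∈ edgesAvoiding F x y | w ∈ E}) :
    #(edgesAvoiding F x y) + #(edgesAvoiding F y x) ≤ 8 := by
  have hall : ∀ E' ∈ edgesAvoiding F y x, w ∈ E' := fun E' h => mem_of_three_le h3 hint hwx hw h
  have hw₀ : w ∉ E₀ := fun h => by have := ht w h; omega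
  have hmeet : ∀ E ∈ F, ∃ t ∈ E₀, t ∈ E := by
    intro E hE
    obtain ⟨t, h⟩ := hint E hE E₀ hE₀
    rw [mem_inter] at h
    exact ⟨t, h.2, h.1⟩
  have h₁ : #(edgesAvoiding F y x) ≤ #E₀ := by
    refine card_le_of_pair_mem (x := y) (y := w) (fun E hE => h3 E (mem_edgesAvoiding.1 hE).1)
      hwy.symm hy₀ hw₀ (fun E hE => ⟨(mem_edgesAvoiding.1 hE).2.1, hall E hE⟩)
      (fun E hE => hmeet E (mem_edgesAvoiding.1 hE).1)
  have h₂ : #{E ∈ edgesAvoiding F x y | w ∈ E} ≤ #E₀ := by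
    refine card_le_of_pair_mem (x := x) (y := w)
      (fun E hE => h3 E (mem_edgesAvoiding.1 (mem_filter.1 hE).1).1)
      hwx.symm hx₀ hw₀ (fun E hE => ⟨(mem_edgesAvoiding.1 (mem_filter.1 hE).1).2.1,
        (mem_filter.1 hE).2⟩)
      (fun E hE => hmeet E (mem_edgesAvoiding.1 (mem_filter.1 hE).1).1)
  rw [h3 _ hE₀] at h₁ h₂
  obtain ⟨E', hE'⟩ := hne
  obtain ⟨t, htE, htx, hty, htw, hle⟩ := card_edgesAvoiding_le_add h3 hint hE' (hall E' hE') hwy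
  have hE'' := mem_edgesAvoiding.1 hE'
  have ht₀ : t ∈ E₀ := by
    obtain ⟨s, hs, hsE⟩ := hmeet E' hE''.1
    have heq := eq_triple_of_mem (h3 _ hE''.1) hwy.symm hty.symm htw.symm hE''.2.1 (hall E' hE') htE
    rw [heq, mem_insert, mem_insert, mem_singleton] at hsE
    rcases hsE with rfl | rfl | rfl
    · exact absurd hs hy₀
    · exact absurd hs hw₀
    · exact hs
  have := ht t ht₀
  omega

/-- Twelve is 3 + 1 + 8: edges through x and y, the edge E₀ avoiding both, and the two sides. -/
theorem card_le_twelve_of_three_le (h3 : ∀ E ∈ F, #E = 3)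
    (hint : ∀ A ∈ F, ∀ B ∈ F, (A ∩ B).Nonempty)
    (hno : ∀ u v, u ≠ v → ∃ E ∈ F, u ∉ E ∧ v ∉ E) {x y : α} (hxy : x ≠ y)
    (hd : 3 ≤ #{E ∈ F | x ∈ E ∧ y ∈ E}) : #F ≤ 12 := by
  obtain ⟨E₀, hE₀, hx₀, hy₀⟩ := hno x y hxy
  have hmeet : ∀ E ∈ F, ∀ E₁ ∈ F, ∃ t ∈ E₁, t ∈ E := by
    intro E hE E₁ hE₁
    obtain ⟨t, h⟩ := hint E hE E₁ hE₁
    rw [mem_inter] at h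
    exact ⟨t, h.2, h.1⟩
  have hbound : ∀ T : Finset α, x ∉ T → y ∉ T → (∀ E ∈ F, x ∈ E → y ∈ E → ∃ t ∈ T, t ∈ E) →
      #{E ∈ F | x ∈ E ∧ y ∈ E} ≤ #T := by
    intro T hxT hyT hT
    refine card_le_of_pair_mem (x := x) (y := y) (fun E hE => h3 E (mem_filter.1 hE).1) hxy hxT hyT
      (fun E hE => (mem_filter.1 hE).2) (fun E hE => ?_)
    rw [mem_filter] at hE
    exact hT E hE.1 hE.2.1 hE.2.2
  have hle3 := hbound E₀ hx₀ hy₀ fun E hE _ _ => hmeet E hE E₀ hE₀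
  rw [h3 _ hE₀] at hle3
  -- the only edge that avoids both `x` and `y` is `E₀`
  have huniq : ∀ E₁ ∈ F, x ∉ E₁ → y ∉ E₁ → E₁ = E₀ := by
    intro E₁ hE₁ hx₁ hy₁
    -- Each edge {x, y, z} has z in both E₁ and E₀, and there are at least three such z.
    have hc : 3 ≤ #(E₁ ∩ E₀) := by
      refine hd.trans (hbound _ (fun h => hx₀ (mem_inter.1 h).2) (fun h => hy₀ (mem_inter.1 h).2) ?_)
      intro E hE hxE hyE
      obtain ⟨t, ht, htE⟩ := hmeet E hE E₁ hE₁
      obtain ⟨s, hs, hsE⟩ := hmeet E hE E₀ hE₀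
      have hE3 := eq_triple_of_mem (h3 E hE) hxy (z := t) (by rintro rfl; exact hx₁ ht)
        (by rintro rfl; exact hy₁ ht) hxE hyE htE
      rw [hE3, mem_insert, mem_insert, mem_singleton] at hsE
      rcases hsE with rfl | rfl | rfl
      · exact absurd hs hx₀
      · exact absurd hs hy₀
      · exact ⟨s, mem_inter.2 ⟨ht, hs⟩, htE⟩
    rw [← eq_of_subset_of_card_le (inter_subset_left : E₁ ∩ E₀ ⊆ E₁) (by rw [h3 _ hE₁]; exact hc)]
    exact eq_of_subset_of_card_le inter_subset_right (by rw [h3 _ hE₀]; exact hc)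
  have hnone : #{E ∈ F | x ∉ E ∧ y ∉ E} ≤ 1 := by
    refine card_le_one.2 fun A hA B hB => ?_
    rw [mem_filter] at hA hB
    rw [huniq A hA.1 hA.2.1 hA.2.2, huniq B hB.1 hB.2.1 hB.2.2]
  -- no vertex of `E₀` together with `x` or `y` is a cover
  have hedge : ∀ u v, (u = x ∧ v = y ∨ u = y ∧ v = x) → ∀ t ∈ E₀,
      ∃ E ∈ edgesAvoiding F v u, t ∉ E := by
    intro u v huv t ht
    have hut : u ≠ t := by
      rintro rfl; rcases huv with ⟨rfl, rfl⟩ | ⟨rfl, rfl⟩ <;> contradiction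
    obtain ⟨E, hE, huE, htE⟩ := hno u t hut
    refine ⟨E, mem_edgesAvoiding.2 ⟨hE, ?_, huE⟩, htE⟩
    by_contra hvE
    have : E = E₀ := by
      rcases huv with ⟨rfl, rfl⟩ | ⟨rfl, rfl⟩
      · exact huniq E hE huE hvE
      · exact huniq E hE hvE huE
    exact htE (this ▸ ht)
  obtain ⟨t₀, ht₀⟩ : E₀.Nonempty := card_pos.1 (by rw [h3 _ hE₀]; norm_num)
  have hdeg : ∀ u v, (u = x ∧ v = y ∨ u = y ∧ v = x) → ∀ t ∈ E₀,
      #{E ∈ edgesAvoiding F u v | t ∈ E} ≤ 2 := by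
    intro u v huv t ht
    obtain ⟨E, hE, htE⟩ := hedge u v huv t ht
    refine card_edgesAvoiding_filter_le_two h3 hint ?_ hE htE
    rintro rfl; rcases huv with ⟨rfl, rfl⟩ | ⟨rfl, rfl⟩ <;> contradiction
  have hsum := card_eq_add_edgesAvoiding F x y
  obtain ⟨B, hB, -⟩ := hedge x y (Or.inl ⟨rfl, rfl⟩) t₀ ht₀
  obtain ⟨A, hA, -⟩ := hedge y x (Or.inr ⟨rfl, rfl⟩) t₀ ht₀
  suffices #(edgesAvoiding F x y) + #(edgesAvoiding F y x) ≤ 8 by omega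
  by_cases h : ∃ w, w ≠ x ∧ w ≠ y ∧ 3 ≤ #{E ∈ edgesAvoiding F x y | w ∈ E}
  · obtain ⟨w, hwx, hwy, hw⟩ := h
    exact card_edgesAvoiding_add_le_eight h3 hint hwx hwy hE₀ hx₀ hy₀ ⟨B, hB⟩
      (hdeg x y (Or.inl ⟨rfl, rfl⟩)) hw
  by_cases h' : ∃ w, w ≠ x ∧ w ≠ y ∧ 3 ≤ #{E ∈ edgesAvoiding F y x | w ∈ E}
  · obtain ⟨w, hwx, hwy, hw⟩ := h'
    rw [add_comm]
    exact card_edgesAvoiding_add_le_eight h3 hint hwy hwx hE₀ hy₀ hx₀ ⟨A, hA⟩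
      (hdeg y x (Or.inr ⟨rfl, rfl⟩)) hw
  push Not at h h'
  have h₁ := card_edgesAvoiding_le h3 hint hB (c := 2)
    fun w _ hwx hwy => Nat.le_of_lt_succ (h w hwx hwy)
  have h₂ := card_edgesAvoiding_le h3 hint hA (c := 2)
    fun w _ hwy hwx => Nat.le_of_lt_succ (h' w hwx hwy)
  omega

theorem card_le_sum_filter_of_mem (hint : ∀ A ∈ F, ∀ B ∈ F, (A ∩ B).Nonempty) {E₀ : Finset α}
    (hE₀ : E₀ ∈ F) {G : Finset (Finset α)} (hG : G ⊆ F) : #G ≤ ∑ t ∈ E₀, #{E ∈ G | t ∈ E} := by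
  refine card_le_sum_card_filter_mem fun E hE => ?_
  obtain ⟨t, h⟩ := hint E (hG hE) E₀ hE₀
  rw [mem_inter] at h
  exact ⟨t, h.2, h.1⟩

theorem card_filter_mem_le_of_pairDegree_le (hint : ∀ A ∈ F, ∀ B ∈ F, (A ∩ B).Nonempty)
    (h3 : ∀ E ∈ F, #E = 3) {c : ℕ} (hpair : ∀ u v, u ≠ v → #{E ∈ F | u ∈ E ∧ v ∈ E} ≤ c)
    {x : α} {E₀ : Finset α} (hE₀ : E₀ ∈ F) (hx : x ∉ E₀) : #{E ∈ F | x ∈ E} ≤ 3 * c := by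
  refine (card_le_sum_filter_of_mem hint hE₀ (filter_subset _ F)).trans ?_
  rw [← h3 E₀ hE₀, ← smul_eq_mul]
  refine sum_le_card_nsmul _ _ _ fun t ht => ?_
  rw [filter_filter]
  exact hpair x t (by rintro rfl; exact hx ht)

/-- Degree six is extremal: each vertex of E₀ accounts for exactly two edges at x, without overlap.
Besides E₀, an edge avoiding x contains a vertex of E₀ but not the cyclically next one, and rigidity
allows one edge per such pattern. The total is at most 6 + 1 + 3. -/
theorem card_le_twelve_of_six_le (h3 : ∀ E ∈ F, #E = 3)
    (hint : ∀ A ∈ F, ∀ B ∈ F, (A ∩ B).Nonempty)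
    (hpair : ∀ u v, u ≠ v → #{E ∈ F | u ∈ E ∧ v ∈ E} ≤ 2) {x : α} {E₀ : Finset α}
    (hE₀ : E₀ ∈ F) (hx : x ∉ E₀) (h6 : 6 ≤ #{E ∈ F | x ∈ E}) : #F ≤ 12 := by
  have hxne : ∀ t ∈ E₀, x ≠ t := by rintro t ht rfl; exact hx ht
  have hle6 := card_filter_mem_le_of_pairDegree_le hint h3 hpair hE₀ hx
  have hpair2 : ∀ t ∈ E₀, 2 ≤ #{E ∈ F | x ∈ E ∧ t ∈ E} := by
    intro t ht
    have h := card_le_sum_filter_of_mem hint hE₀ (filter_subset (fun E => x ∈ E) F)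
    rw [← add_sum_erase _ _ ht] at h
    have h' : ∑ s ∈ E₀.erase t, #{E ∈ {E ∈ F | x ∈ E} | s ∈ E} ≤ #(E₀.erase t) • 2 := by
      refine sum_le_card_nsmul _ _ _ fun s hs => ?_
      rw [filter_filter]
      exact hpair x s (hxne s (mem_of_mem_erase hs))
    rw [card_erase_of_mem ht, h3 _ hE₀, smul_eq_mul] at h'
    rw [filter_filter] at h
    omega
  have hdisj : ∀ a ∈ E₀, ∀ b ∈ E₀, a ≠ b → ∀ A ∈ F, x ∈ A → b ∈ A → a ∉ A := by
    intro a ha b hb hab A hA hxA hbA haA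
    -- If A contained both a and b, the other five edges at x would be counted by 1 + 1 + 2.
    have h := card_le_sum_filter_of_mem hint hE₀
      ((erase_subset A _).trans (filter_subset (fun E => x ∈ E) F))
    rw [card_erase_of_mem (mem_filter.2 ⟨hA, hxA⟩), ← add_sum_erase _ _ ha,
      ← add_sum_erase _ _ (mem_erase.2 ⟨hab.symm, hb⟩)] at h
    have hle : ∀ s ∈ E₀, #{E ∈ {E ∈ F | x ∈ E}.erase A | s ∈ E} ≤ 2 := by
      intro s hs
      refine (card_le_card (filter_subset_filter _ (erase_subset _ _))).trans ?_
      rw [filter_filter]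
      exact hpair x s (hxne s hs)
    have hle1 : ∀ s ∈ E₀, s ∈ A → #{E ∈ {E ∈ F | x ∈ E}.erase A | s ∈ E} ≤ 1 := by
      intro s hs hsA
      rw [filter_erase, filter_filter,
        card_erase_of_mem (mem_filter.2 ⟨hA, hxA, hsA⟩)]
      have := hpair x s (hxne s hs)
      omega
    have h' : ∑ s ∈ (E₀.erase a).erase b, #{E ∈ {E ∈ F | x ∈ E}.erase A | s ∈ E} ≤
        #((E₀.erase a).erase b) • 2 :=
      sum_le_card_nsmul _ _ _ fun s hs => hle s (mem_of_mem_erase (mem_of_mem_erase hs))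
    rw [card_erase_of_mem (mem_erase.2 ⟨hab.symm, hb⟩), card_erase_of_mem ha, h3 _ hE₀,
      smul_eq_mul] at h'
    have := hle1 a ha haA
    have := hle1 b hb hbA
    omega
  have hstep : ∀ a ∈ E₀, ∀ b ∈ E₀, a ≠ b → #{E ∈ F | x ∉ E ∧ a ∈ E ∧ b ∉ E} ≤ 1 := by
    intro a ha b hb hab
    obtain ⟨A₁, hA₁, A₂, hA₂, hne⟩ := one_lt_card.1 (hpair2 b hb)
    rw [mem_filter] at hA₁ hA₂
    have key : ∀ E ∈ F, x ∉ E → a ∈ E → b ∉ E → ∀ A ∈ F, x ∈ A → b ∈ A →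
        ∃ t ∈ E, A = {x, b, t} ∧ t ≠ a := by
      intro E hE hxE haE hbE A hA hxA hbA
      obtain ⟨t, ht⟩ := hint E hE A hA
      rw [mem_inter] at ht
      refine ⟨t, ht.1, eq_triple_of_mem (h3 A hA) (hxne b hb) ?_ ?_ hxA hbA ht.2, ?_⟩
      · rintro rfl; exact hxE ht.1
      · rintro rfl; exact hbE ht.1
      · rintro rfl; exact hdisj t ha b hb hab A hA hxA hbA ht.2
    -- The third vertices of A₁ and A₂ both lie in E, which determines E.
    have key2 : ∀ E ∈ F, x ∉ E → a ∈ E → b ∉ E → E = insert a ((A₁ ∪ A₂) \ {x, b}) := by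
      intro E hE hxE haE hbE
      obtain ⟨t₁, ht₁, e₁, n₁⟩ := key E hE hxE haE hbE A₁ hA₁.1 hA₁.2.1 hA₁.2.2
      obtain ⟨t₂, ht₂, e₂, n₂⟩ := key E hE hxE haE hbE A₂ hA₂.1 hA₂.2.1 hA₂.2.2
      have h12 : t₁ ≠ t₂ := by rintro rfl; exact hne (e₁.trans e₂.symm)
      rw [eq_triple_of_mem (h3 E hE) n₁.symm n₂.symm h12 haE ht₁ ht₂, e₁, e₂]
      have hx₁ : t₁ ≠ x := by rintro rfl; exact hxE ht₁
      have hx₂ : t₂ ≠ x := by rintro rfl; exact hxE ht₂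
      have hb₁ : t₁ ≠ b := by rintro rfl; exact hbE ht₁
      have hb₂ : t₂ ≠ b := by rintro rfl; exact hbE ht₂
      ext s
      simp only [mem_insert, mem_singleton, mem_sdiff, mem_union]
      constructor
      · rintro (rfl | rfl | rfl) <;> simp [*]
      · rintro (rfl | ⟨(rfl | rfl | rfl) | (rfl | rfl | rfl), h⟩) <;> simp_all
    refine card_le_one.2 fun E hE E' hE' => ?_
    rw [mem_filter] at hE hE'
    rw [key2 E hE.1 hE.2.1 hE.2.2.1 hE.2.2.2, key2 E' hE'.1 hE'.2.1 hE'.2.2.1 hE'.2.2.2]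
  obtain ⟨a, b, c, hab, hac, hbc, rfl⟩ := card_eq_three.1 (h3 _ hE₀)
  have hcover : {E ∈ F | x ∉ E} ⊆ {{a, b, c}} ∪ ({E ∈ F | x ∉ E ∧ a ∈ E ∧ b ∉ E} ∪
      ({E ∈ F | x ∉ E ∧ b ∈ E ∧ c ∉ E} ∪ {E ∈ F | x ∉ E ∧ c ∈ E ∧ a ∉ E})) := by
    intro E hE
    simp only [mem_filter] at hE
    simp only [mem_union, mem_filter, mem_singleton, hE.1, hE.2, true_and, not_false_eq_true]
    obtain ⟨t, ht⟩ := hint E hE.1 _ hE₀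
    simp only [mem_inter, mem_insert, mem_singleton] at ht
    by_cases ha : a ∈ E <;> by_cases hb : b ∈ E <;> by_cases hc : c ∈ E <;> simp [ha, hb, hc]
    · exact eq_triple_of_mem (h3 E hE.1) hab hac hbc ha hb hc
    · rcases ht with ⟨h, rfl | rfl | rfl⟩ <;> contradiction
  have h4 := (card_le_card hcover).trans ((card_union_le _ _).trans (Nat.add_le_add_left
    ((card_union_le _ _).trans (Nat.add_le_add_left (card_union_le _ _) _)) _))
  rw [card_singleton] at h4
  have h₁ := hstep a (by simp) b (by simp) hab
  have h₂ := hstep b (by simp) c (by simp) hbc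
  have h₃ := hstep c (by simp) a (by simp) hac.symm
  have := card_filter_add_card_filter_not (s := F) (fun E => x ∈ E)
  omega

/-- Intersecting triples without a cover of size two. -/
theorem card_le_twelve (h3 : ∀ E ∈ F, #E = 3) (hint : ∀ A ∈ F, ∀ B ∈ F, (A ∩ B).Nonempty)
    (hno : ∀ u v, u ≠ v → ∃ E ∈ F, u ∉ E ∧ v ∉ E) : #F ≤ 12 := by
  by_cases hd : ∃ x y, x ≠ y ∧ 3 ≤ #{E ∈ F | x ∈ E ∧ y ∈ E}
  · obtain ⟨x, y, hxy, hd⟩ := hd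
    exact card_le_twelve_of_three_le h3 hint hno hxy hd
  push Not at hd
  have hpair : ∀ u v, u ≠ v → #{E ∈ F | u ∈ E ∧ v ∈ E} ≤ 2 :=
    fun u v huv => Nat.le_of_lt_succ (hd u v huv)
  rcases F.eq_empty_or_nonempty with rfl | ⟨E₁, hE₁⟩
  · simp
  have hmiss : ∀ v, ∃ E ∈ F, v ∉ E := by
    intro v
    obtain ⟨w, hw⟩ : ∃ w, v ≠ w := by
      obtain ⟨a, b, c, hab, -, -, -⟩ := card_eq_three.1 (h3 _ hE₁)
      by_cases h : v = a
      · exact ⟨b, h ▸ hab⟩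
      · exact ⟨a, h⟩
    obtain ⟨E, hE, h, -⟩ := hno v w hw
    exact ⟨E, hE, h⟩
  by_cases h6 : ∃ x, 6 ≤ #{E ∈ F | x ∈ E}
  · obtain ⟨x, h6⟩ := h6
    obtain ⟨E₀, hE₀, hx⟩ := hmiss x
    exact card_le_twelve_of_six_le h3 hint hpair hE₀ hx h6
  push Not at h6
  by_cases h2 : ∃ x y, x ≠ y ∧ 2 ≤ #{E ∈ F | x ∈ E ∧ y ∈ E}
  · obtain ⟨x, y, hxy, h2⟩ := h2
    -- All degrees are at most five, so besides E and E', which share x and y, at most 3 + 3 + 4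
    -- edges meet E.
    obtain ⟨E, hE, E', hE', hne⟩ := one_lt_card.1 h2
    rw [mem_filter] at hE hE'
    have hG : (F.erase E).erase E' ⊆ F := (erase_subset _ _).trans (erase_subset _ _)
    have hE'e : E' ∈ F.erase E := mem_erase.2 ⟨hne.symm, hE'.1⟩
    have h := card_le_sum_filter_of_mem hint hE.1 hG
    rw [card_erase_of_mem hE'e, card_erase_of_mem hE.1, ← add_sum_erase _ _ hE.2.1,
      ← add_sum_erase _ _ (mem_erase.2 ⟨hxy.symm, hE.2.2⟩)] at h
    have hthree : ∀ v, v ∈ E → v ∈ E' → #{A ∈ (F.erase E).erase E' | v ∈ A} ≤ 3 := by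
      intro v hv hv'
      rw [filter_erase, filter_erase, card_erase_of_mem, card_erase_of_mem]
      · have := h6 v; omega
      · exact mem_filter.2 ⟨hE.1, hv⟩
      · exact mem_erase.2 ⟨hne.symm, mem_filter.2 ⟨hE'.1, hv'⟩⟩
    have hfour : ∀ v, v ∈ E → #{A ∈ (F.erase E).erase E' | v ∈ A} ≤ 4 := by
      intro v hv
      rw [filter_erase, filter_erase]
      refine (card_le_card (erase_subset _ _)).trans ?_
      rw [card_erase_of_mem (mem_filter.2 ⟨hE.1, hv⟩)]
      have := h6 v; omega
    have h' : ∑ s ∈ (E.erase x).erase y, #{A ∈ (F.erase E).erase E' | s ∈ A} ≤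
        #((E.erase x).erase y) • 4 :=
      sum_le_card_nsmul _ _ _ fun s hs => hfour s (mem_of_mem_erase (mem_of_mem_erase hs))
    rw [card_erase_of_mem (mem_erase.2 ⟨hxy.symm, hE.2.2⟩), card_erase_of_mem hE.2.1, h3 _ hE.1,
      smul_eq_mul] at h'
    have := hthree x hE.2.1 hE'.2.1
    have := hthree y hE.2.2 hE'.2.2
    omega
  · push Not at h2
    refine (card_le_sum_filter_of_mem hint hE₁ (Subset.refl F)).trans ?_
    refine (sum_le_card_nsmul _ _ 3 fun t _ => ?_).trans (by rw [h3 _ hE₁]; norm_num)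
    obtain ⟨E₀, hE₀, ht⟩ := hmiss t
    exact card_filter_mem_le_of_pairDegree_le (c := 1) hint h3
      (fun u v huv => Nat.le_of_lt_succ (h2 u v huv)) hE₀ ht

/-- If all pair degrees are at most `m`, and no vertex lies in three pairs of degree `m` without
an edge that joins two of them, then non-trivial intersecting subgraphs have size at most `3 m`. -/
theorem noNontrivialIntersectingSubgraph_of_pairDegree {n m : ℕ} (hm : 4 ≤ m)
    {H : Finset (Finset (Fin n))} (h3 : IsThreeGraph H)
    (hpair : ∀ u v, u ≠ v → pairDegree H u v ≤ m)
    (hstar : ∀ x a b c, x ≠ a → x ≠ b → x ≠ c → a ≠ b → a ≠ c → b ≠ c → pairDegree H x a = m →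
      pairDegree H x b = m → pairDegree H x c = m →
      {x, a, b} ∈ H ∨ {x, a, c} ∈ H ∨ {x, b, c} ∈ H) :
    NoNontrivialIntersectingSubgraph H (3 * m + 1) := by
  rintro F hFH hF ⟨hint, hno⟩
  push Not at hno
  have h3F : ∀ E ∈ F, #E = 3 := fun E hE => h3 E (hFH hE)
  by_cases hcov : ∀ u v, u ≠ v → ∃ E ∈ F, u ∉ E ∧ v ∉ E
  · have := card_le_twelve h3F hint hcov
    omega
  push Not at hcov
  obtain ⟨x, y, hxy, hcov⟩ := hcov
  have := card_le_of_cover_pair hm h3F hint hno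
    (fun u v huv => (card_le_card (filter_subset_filter _ hFH)).trans (hpair u v huv)) ?_ hxy
    (fun E hE => or_iff_not_imp_left.2 (hcov E hE))
  · omega
  -- The union of three sets of size at most m has fewer than 3m members: one set is smaller than m,
  -- or an edge given by `hstar` lies in two of them.
  intro x E₀ hE₀ hx
  obtain ⟨a, b, c, hab, hac, hbc, rfl⟩ := card_eq_three.1 (h3F _ hE₀)
  simp only [mem_insert, mem_singleton, not_or] at hx
  obtain ⟨hxa, hxb, hxc⟩ := hx
  refine (Nat.add_le_add_right (card_le_card (t := {E ∈ H | x ∈ E ∧ a ∈ E} ∪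
    {E ∈ H | x ∈ E ∧ b ∈ E} ∪ {E ∈ H | x ∈ E ∧ c ∈ E}) fun E => ?_) 1).trans ?_
  · simp only [mem_filter, mem_union, mem_insert, mem_singleton, exists_eq_or_imp, exists_eq_left]
    rintro ⟨hE, hxE, h⟩
    have := hFH hE
    tauto
  have ha := hpair x a hxa
  have hb := hpair x b hxb
  have hc := hpair x c hxc
  have hs := hstar x a b c hxa hxb hxc hab hac hbc
  unfold pairDegree at ha hb hc hs
  have overlap : ∀ (u v : Fin n) (P : Finset (Finset (Fin n))), {x, u, v} ∈ H → {x, u, v} ∈ P →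
      #(P ∪ {E ∈ H | x ∈ E ∧ v ∈ E}) + 1 ≤ #P + #{E ∈ H | x ∈ E ∧ v ∈ E} := by
    intro u v P h hP
    rw [← card_union_add_card_inter]
    exact Nat.add_le_add_left (card_pos.2 ⟨_, mem_inter.2 ⟨hP, mem_filter.2 ⟨h, by simp⟩⟩⟩) _
  have h₁ := card_union_le {E ∈ H | x ∈ E ∧ a ∈ E} {E ∈ H | x ∈ E ∧ b ∈ E}
  have h₂ := card_union_le ({E ∈ H | x ∈ E ∧ a ∈ E} ∪ {E ∈ H | x ∈ E ∧ b ∈ E})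
    {E ∈ H | x ∈ E ∧ c ∈ E}
  by_cases hall : #{E ∈ H | x ∈ E ∧ a ∈ E} = m ∧ #{E ∈ H | x ∈ E ∧ b ∈ E} = m ∧
      #{E ∈ H | x ∈ E ∧ c ∈ E} = m
  · rcases hs hall.1 hall.2.1 hall.2.2 with h | h | h
    · have := overlap a b {E ∈ H | x ∈ E ∧ a ∈ E} h (mem_filter.2 ⟨h, by simp⟩)
      omega
    · have := overlap a c ({E ∈ H | x ∈ E ∧ a ∈ E} ∪ {E ∈ H | x ∈ E ∧ b ∈ E}) h
        (mem_union_left _ (mem_filter.2 ⟨h, by simp⟩))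
      omega
    · have := overlap b c ({E ∈ H | x ∈ E ∧ a ∈ E} ∪ {E ∈ H | x ∈ E ∧ b ∈ E}) h
        (mem_union_right _ (mem_filter.2 ⟨h, by simp⟩))
      omega
  · omega

end Intersecting

/-! ### Pair degrees, edge counts, and a Steiner system plus a matching -/

section Degrees
open Finset

theorem pairDegree_comm {n : ℕ} (H : Finset (Finset (Fin n))) (u v : Fin n) :
    pairDegree H u v = pairDegree H v u := by
  unfold pairDegree
  rw [filter_congr fun _ _ => and_comm]

theorem sum_offDiag_pairDegree {n : ℕ} {H : Finset (Finset (Fin n))} (h3 : IsThreeGraph H) :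
    ∑ p ∈ (univ : Finset (Fin n)).offDiag, pairDegree H p.1 p.2 = 6 * #H := by
  unfold pairDegree
  simp only [card_filter]
  rw [sum_comm, mul_comm, ← smul_eq_mul]
  refine sum_eq_card_nsmul fun E hE => ?_
  rw [← card_filter]
  have : {p ∈ (univ : Finset (Fin n)).offDiag | p.1 ∈ E ∧ p.2 ∈ E} = E.offDiag := by
    ext p; simp only [mem_filter, mem_offDiag, mem_univ, true_and]; tauto
  rw [this, offDiag_card, h3 E hE]

/-- The term 2n amounts to n/3 extra edges with six ordered pairs each; no matching need be present,
which the even case exploits. -/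
theorem card_eq_of_sum_pairDegree {n m : ℕ} (hm : 1 ≤ m) {H : Finset (Finset (Fin n))}
    (h3 : IsThreeGraph H)
    (hsum : ∑ p ∈ (univ : Finset (Fin n)).offDiag, pairDegree H p.1 p.2 =
      (m - 1) * #(univ : Finset (Fin n)).offDiag + 2 * n) :
    (#H : ℚ) = ((m : ℚ) - 1) / 3 * (n.choose 2 : ℚ) + (n : ℚ) / 3 := by
  rw [sum_offDiag_pairDegree h3, offDiag_card, card_univ, Fintype.card_fin] at hsum
  have h := congrArg (Nat.cast : ℕ → ℚ) hsum
  rw [Nat.cast_add, Nat.cast_mul, Nat.cast_mul, Nat.cast_sub hm, Nat.cast_sub (Nat.le_mul_self n)]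
    at h
  push_cast at h
  rw [Nat.cast_choose_two]
  linarith

theorem three_mul_card_of_isPerfectTripleMatching {n : ℕ} {M : Finset (Finset (Fin n))}
    (hM : IsPerfectTripleMatching M) : 3 * #M = n := by
  have h : M.biUnion id = univ := by
    ext v
    obtain ⟨E, hE, hv⟩ := hM.2.2 v
    simpa using ⟨E, hE, hv⟩
  have hc := card_biUnion (s := M) (t := id) fun A hA B hB hAB => hM.2.1 A hA B hB hAB
  rw [h, card_univ, Fintype.card_fin, sum_const_nat (m := 3) (f := fun E => #(id E)) fun E hE => hM.1 E hE] at hc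
  omega

theorem pairDegree_union_of_disjoint {n : ℕ} {S M : Finset (Finset (Fin n))} (h : Disjoint S M)
    (u v : Fin n) : pairDegree (S ∪ M) u v = pairDegree S u v + pairDegree M u v := by
  unfold pairDegree
  rw [filter_union, card_union_of_disjoint (disjoint_filter_filter h)]

theorem eq_of_mem_of_isPerfectTripleMatching {n : ℕ} {M : Finset (Finset (Fin n))}
    (hM : IsPerfectTripleMatching M) {v : Fin n} {A B : Finset (Fin n)} (hA : A ∈ M) (hB : B ∈ M)
    (hvA : v ∈ A) (hvB : v ∈ B) : A = B := by
  by_contra h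
  exact disjoint_left.1 (hM.2.1 A hA B hB h) hvA hvB

theorem steiner_union_matching {m : ℕ} (hm : 4 ≤ m) (n : ℕ) (S M : Finset (Finset (Fin n)))
    (hS : IsSteinerTripleSystem S (m - 1)) (hM : IsPerfectTripleMatching M)
    (hMS : M ⊆ tripleComplement S) :
    IsThreeGraph (S ∪ M) ∧
      ((S ∪ M).card : ℚ) = ((m : ℚ) - 1) / 3 * (n.choose 2 : ℚ) + (n : ℚ) / 3 ∧
      NoNontrivialIntersectingSubgraph (S ∪ M) (3 * m + 1) := by
  have h3 : IsThreeGraph (S ∪ M) := fun E hE => (mem_union.1 hE).elim (hS.1 E) (hM.1 E)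
  have hdisj : Disjoint S M :=
    disjoint_right.2 fun E hE => (mem_sdiff.1 (hMS hE)).2
  have hdeg : ∀ u v, u ≠ v → pairDegree (S ∪ M) u v = m - 1 + pairDegree M u v := fun u v huv => by
    rw [pairDegree_union_of_disjoint hdisj, hS.2 u v huv]
  refine ⟨h3, ?_, ?_⟩
  · refine card_eq_of_sum_pairDegree (by omega) h3 ?_
    rw [sum_congr rfl fun p hp => hdeg p.1 p.2 (mem_offDiag.1 hp).2.2, sum_add_distrib,
      sum_offDiag_pairDegree hM.1, sum_const, smul_eq_mul, mul_comm]
    have := three_mul_card_of_isPerfectTripleMatching hM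
    omega
  · refine noNontrivialIntersectingSubgraph_of_pairDegree hm h3 ?_ ?_
    · intro u v huv
      have : pairDegree M u v ≤ 1 := card_le_one.2 fun A hA B hB => by
        rw [mem_filter] at hA hB
        exact eq_of_mem_of_isPerfectTripleMatching hM hA.1 hB.1 hA.2.1 hB.2.1
      have := hdeg u v huv
      omega
    · intro x a b c hxa hxb hxc hab hac hbc ha hb hc
      -- All three pairs would lie in the one matching edge at x, which has only two other vertices.
      exfalso
      have key : ∀ t, x ≠ t → pairDegree (S ∪ M) x t = m → ∃ E ∈ M, x ∈ E ∧ t ∈ E := by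
        intro t hxt ht
        rw [hdeg x t hxt] at ht
        obtain ⟨E, hE⟩ := card_pos.1 (show 0 < pairDegree M x t by omega)
        exact ⟨E, (mem_filter.1 hE).1, (mem_filter.1 hE).2⟩
      obtain ⟨A, hA, hxA, haA⟩ := key a hxa ha
      obtain ⟨B, hB, hxB, hbB⟩ := key b hxb hb
      obtain ⟨C, hC, hxC, hcC⟩ := key c hxc hc
      obtain rfl := eq_of_mem_of_isPerfectTripleMatching hM hA hB hxA hxB
      obtain rfl := eq_of_mem_of_isPerfectTripleMatching hM hA hC hxA hxC
      rw [eq_triple_of_mem (hM.1 _ hA) hxa hxb hab hxA haA hbB] at hcC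
      simp only [mem_insert, mem_singleton] at hcC
      rcases hcC with rfl | rfl | rfl <;> contradiction

end Degrees

/-! ### Triples from a symmetric ternary relation -/

section TripleGraph
open Finset

variable {V : Type*} {n : ℕ}

open Classical in
/-- The `3`-graph on `Fin n` given by a symmetric ternary relation on a type equivalent to `Fin n`. -/
noncomputable def tripleGraph (e : V ≃ Fin n) (R : V → V → V → Prop) : Finset (Finset (Fin n)) :=
  {E ∈ powersetCard 3 univ | ∀ u v w, E = {e u, e v, e w} → R u v w}

theorem mem_tripleGraph_iff {e : V ≃ Fin n} {R : V → V → V → Prop} {E : Finset (Fin n)} :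
    E ∈ tripleGraph e R ↔ #E = 3 ∧ ∀ u v w, E = {e u, e v, e w} → R u v w := by
  simp [tripleGraph, mem_powersetCard]

theorem isThreeGraph_tripleGraph (e : V ≃ Fin n) (R : V → V → V → Prop) :
    IsThreeGraph (tripleGraph e R) := fun _ hE => (mem_tripleGraph_iff.1 hE).1

theorem mem_tripleGraph {e : V ≃ Fin n} {R : V → V → V → Prop}
    (h12 : ∀ u v w, R u v w → R v u w) (h23 : ∀ u v w, R u v w → R u w v)
    {u v w : V} (huv : u ≠ v) (huw : u ≠ w) (hvw : v ≠ w) :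
    {e u, e v, e w} ∈ tripleGraph e R ↔ R u v w := by
  have hcard : #({e u, e v, e w} : Finset (Fin n)) = 3 :=
    card_eq_three.2 ⟨_, _, _, e.injective.ne huv, e.injective.ne huw, e.injective.ne hvw, rfl⟩
  constructor
  · intro h; exact (mem_tripleGraph_iff.1 h).2 u v w rfl
  · intro h
    refine mem_tripleGraph_iff.2 ⟨hcard, fun u' v' w' heq => ?_⟩
    have hc' := hcard
    rw [heq] at hc'
    obtain ⟨a, b, c⟩ : u' ≠ v' ∧ u' ≠ w' ∧ v' ≠ w' := by
      refine ⟨?_, ?_, ?_⟩ <;> rintro rfl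
      · have := card_le_two (a := e u') (b := e w')
        rw [insert_eq_of_mem (mem_insert_self _ _)] at hc'
        omega
      · have := card_le_two (a := e v') (b := e u')
        rw [insert_comm, pair_eq_singleton] at hc'
        omega
      · have := card_le_two (a := e u') (b := e v')
        rw [pair_eq_singleton] at hc'
        omega
    have hu : e u' ∈ ({e u, e v, e w} : Finset (Fin n)) := by rw [heq]; simp
    have hv : e v' ∈ ({e u, e v, e w} : Finset (Fin n)) := by rw [heq]; simp
    have hw : e w' ∈ ({e u, e v, e w} : Finset (Fin n)) := by rw [heq]; simp
    simp only [mem_insert, mem_singleton, e.injective.eq_iff] at hu hv hw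
    rcases hu with rfl | rfl | rfl <;> rcases hv with rfl | rfl | rfl <;>
      rcases hw with rfl | rfl | rfl <;> first | contradiction | skip
    · exact h
    · exact h23 _ _ _ h
    · exact h12 _ _ _ h
    · exact h23 _ _ _ (h12 _ _ _ h)
    · exact h12 _ _ _ (h23 _ _ _ h)
    · exact h12 _ _ _ (h23 _ _ _ (h12 _ _ _ h))

open Classical in
theorem pairDegree_tripleGraph [Fintype V] {e : V ≃ Fin n} {R : V → V → V → Prop}
    (h12 : ∀ u v w, R u v w → R v u w) (h23 : ∀ u v w, R u v w → R u w v)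
    {u v : V} (huv : u ≠ v) :
    pairDegree (tripleGraph e R) (e u) (e v) = #{w : V | w ≠ u ∧ w ≠ v ∧ R u v w} := by
  symm
  refine card_bij (fun w _ => {e u, e v, e w}) ?_ ?_ ?_
  · intro w hw
    simp only [mem_filter, mem_univ, true_and] at hw
    exact mem_filter.2 ⟨(mem_tripleGraph h12 h23 huv hw.1.symm hw.2.1.symm).2 hw.2.2, by simp⟩
  · intro w hw w' hw' h
    simp only [mem_filter, mem_univ, true_and] at hw hw'
    have : e w ∈ ({e u, e v, e w'} : Finset (Fin n)) := by rw [← h]; simp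
    simpa [e.injective.eq_iff, hw.1, hw.2.1] using this
  · intro E hE
    obtain ⟨hE, hu, hv⟩ := mem_filter.1 hE
    have hc := isThreeGraph_tripleGraph e R E hE
    obtain ⟨z, hz⟩ : ((E.erase (e u)).erase (e v)).Nonempty := by
      refine card_pos.1 ?_
      rw [card_erase_of_mem (mem_erase.2 ⟨e.injective.ne huv.symm, hv⟩), card_erase_of_mem hu, hc]
      norm_num
    obtain ⟨w, rfl⟩ := e.surjective z
    simp only [mem_erase] at hz
    have hwv : w ≠ v := fun h => hz.1 (h ▸ rfl)
    have hwu : w ≠ u := fun h => hz.2.1 (h ▸ rfl)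
    have hEq := eq_triple_of_mem hc (e.injective.ne huv) (e.injective.ne hwu.symm)
      (e.injective.ne hwv.symm) hu hv hz.2.2
    refine ⟨w, ?_, hEq.symm⟩
    simp only [mem_filter, mem_univ, true_and]
    refine ⟨hwu, hwv, (mem_tripleGraph h12 h23 huv hwu.symm hwv.symm).1 (hEq ▸ hE)⟩

end TripleGraph

/-! ### The three-level construction and its pair degrees -/

section Construction
open Finset

/-- A map `z ↦ 2 z + emb (bit z)` that is bijective, where the bit can be read off from the value
modulo doubles. It makes `(x, y) ↦ z` with `x + y = 2 z + emb (bit z)` a commutative quasigroup. -/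
structure Halving (X B : Type*) [AddCommGroup X] where
  bit : X → B
  emb : B → X
  bijective : Function.Bijective fun z => z + z + emb (bit z)
  sep : ∀ u v b c, u + u + emb b = v + v + emb c → b = c

/-- Shifts between three cyclically ordered levels that sum to zero and have distinct doubles. -/
structure Shifts (X : Type*) [AddCommGroup X] (K : ℕ) where
  a : Fin 3 → ℕ → X
  sum_eq_zero : ∀ i k, a i k + a (i + 1) k + a (i + 2) k = 0
  inj : ∀ i k l, k ≤ K → l ≤ K → a i k + a i k = a i l + a i l → k = l

variable {X B : Type*} [AddCommGroup X] {K : ℕ}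

/-- Doubling need not be injective; the bit tells apart elements with the same double. -/
theorem Halving.existsUnique (h : Halving X B) (c : X) (b : B) :
    ∃! w, w + w = c + c ∧ h.bit w = b := by
  obtain ⟨w, hw⟩ := h.bijective.2 (c + c + h.emb b)
  have hb := h.sep _ _ _ _ hw
  refine ⟨w, ⟨?_, hb⟩, ?_⟩
  · simpa [hb] using hw
  · rintro w' ⟨h₁, h₂⟩
    refine h.bijective.1 ?_
    simp only [] at hw ⊢
    rw [hw, h₁, h₂]

namespace Shifts

variable (s : Shifts X K)

/-- The doubles of `x` (on level `i`) and `y` (on the next level) differ by the `k`-th shift. -/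
def Step (i : Fin 3) (k : ℕ) (x y : X) : Prop :=
  y + y = x + x + (s.a i k + s.a i k)

/-- Whether `{(x, i), (y, i), (z, i + 1)}` is an edge. -/
def Mixed (h : Halving X B) (D : Finset (ℕ × B)) (i : Fin 3) (x y z : X) : Prop :=
  ∃ p ∈ D, x + y + (s.a i p.1 + s.a i p.1) + h.emb p.2 = z + z + h.emb (h.bit z)

/-- The transversal triples along the unused shift `K`. -/
def matchingTriple {n : ℕ} (e : X × Fin 3 ≃ Fin n) (x : X) : Finset (Fin n) :=
  {e (x, 0), e (x + s.a 0 K, 1), e (x + s.a 0 K + s.a 1 K, 2)}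

variable {s} {h : Halving X B} {D : Finset (ℕ × B)}

theorem Mixed.symm {i : Fin 3} {x y z : X} (hm : s.Mixed h D i x y z) : s.Mixed h D i y x z := by
  obtain ⟨p, hp, hm⟩ := hm
  exact ⟨p, hp, by rw [add_comm y x, hm]⟩

/-- The shifts around the three levels cancel, so two steps close up. Hence transversal edges look
the same from every level. -/
theorem Step.trans {i : Fin 3} {k : ℕ} {x y z : X} (h₁ : s.Step i k x y)
    (h₂ : s.Step (i + 1) k y z) : s.Step (i + 2) k z x := by
  unfold Step at *
  have h0 := s.sum_eq_zero i k
  rw [h₂, h₁]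
  have : s.a (i + 2) k = - (s.a i k + s.a (i + 1) k) := by
    rw [eq_neg_iff_add_eq_zero, add_comm, h0]
  rw [this]
  abel

theorem shift_injOn (hD : ∀ p ∈ D, p.1 < K) (i : Fin 3) {p r : ℕ × B} (hp : p ∈ D) (hr : r ∈ D)
    (heq : s.a i p.1 + s.a i p.1 + h.emb p.2 = s.a i r.1 + s.a i r.1 + h.emb r.2) : p = r := by
  have hb := h.sep _ _ _ _ heq
  rw [hb] at heq
  exact Prod.ext (s.inj i _ _ (hD p hp).le (hD r hr).le (add_right_cancel heq)) hb

/-- These degenerate solutions are not triples; they are the losses that transversal edges repair.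
-/
theorem mixed_self_iff {i : Fin 3} {x z : X} :
    s.Mixed h D i x x z ↔ ∃ k, (k, h.bit z) ∈ D ∧ s.Step i k x z := by
  constructor
  · rintro ⟨⟨k, b⟩, hp, heq⟩
    have heq' : (x + s.a i k) + (x + s.a i k) + h.emb b = z + z + h.emb (h.bit z) := by
      rw [← heq]; abel
    obtain rfl := h.sep _ _ _ _ heq'
    exact ⟨k, hp, (add_right_cancel heq).symm⟩
  · rintro ⟨k, hk, hs⟩
    exact ⟨_, hk, by rw [hs]⟩

theorem Step.unique {i : Fin 3} {k l : ℕ} {x z : X} (hk : k < K) (hl : l < K)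
    (h₁ : s.Step i k x z) (h₂ : s.Step i l x z) : k = l :=
  s.inj i k l hk.le hl.le (add_left_cancel (h₁.symm.trans h₂))

theorem exists_step (i : Fin 3) (k : ℕ) (h : Halving X B) (x : X) (b : B) :
    ∃! z, s.Step i k x z ∧ h.bit z = b := by
  have := h.existsUnique (x + s.a i k) b
  rwa [show x + s.a i k + (x + s.a i k) = x + x + (s.a i k + s.a i k) by abel] at this

theorem exists_step_left (i : Fin 3) (k : ℕ) (h : Halving X B) (z : X) (b : B) :
    ∃! x, s.Step i k x z ∧ h.bit x = b := by
  have := h.existsUnique (z - s.a i k) b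
  convert this using 3 with x
  unfold Step
  constructor
  · intro e
    rw [show z - s.a i k + (z - s.a i k) = z + z - (s.a i k + s.a i k) by abel, e,
      add_sub_cancel_right]
  · intro e; rw [e]; abel

variable (s) in
/-- The mixed edges, with the vertex on its own level in the last place. -/
def MixedEdge (h : Halving X B) (D : Finset (ℕ × B)) (u v w : X × Fin 3) : Prop :=
  u.2 = v.2 ∧ w.2 = u.2 + 1 ∧ s.Mixed h D u.2 u.1 v.1 w.1

theorem MixedEdge.symm {u v w : X × Fin 3} (hm : s.MixedEdge h D u v w) :
    s.MixedEdge h D v u w := by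
  obtain ⟨h₁, h₂, hm⟩ := hm
  exact ⟨h₁.symm, h₁ ▸ h₂, h₁ ▸ hm.symm⟩

open Classical in
theorem card_mixed [Fintype X] (hD : ∀ p ∈ D, p.1 < K) (i : Fin 3) (x z : X) :
    #{y | s.Mixed h D i y x z} = #D := by
  symm
  refine card_bij (fun p _ => z + z + h.emb (h.bit z) - x - (s.a i p.1 + s.a i p.1 + h.emb p.2))
    ?_ ?_ ?_
  · intro p hp
    rw [mem_filter]
    exact ⟨mem_univ _, p, hp, by abel⟩
  · intro p hp r hr heq
    exact shift_injOn hD i hp hr (sub_right_injective heq)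
  · intro y hy
    obtain ⟨p, hp, heq⟩ := (mem_filter.1 hy).2
    exact ⟨p, hp, by rw [← heq]; abel⟩

theorem mem_matchingTriple {n : ℕ} {e : X × Fin 3 ≃ Fin n} {x y : X} {j : Fin 3} :
    e (y, j) ∈ s.matchingTriple e x ↔ j = 0 ∧ y = x ∨ j = 1 ∧ y = x + s.a 0 K ∨
      j = 2 ∧ y = x + s.a 0 K + s.a 1 K := by
  simp only [matchingTriple, mem_insert, mem_singleton, e.injective.eq_iff, Prod.mk.injEq]
  tauto

variable [AddCommGroup B]

variable (s) in
/-- Whether `{(x, i), (y, i + 1), (z, i + 2)}` is an edge. -/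
def Transversal (h : Halving X B) (τ : B) (i : Fin 3) (x y z : X) : Prop :=
  ∃ k < K, s.Step i k x y ∧ s.Step (i + 1) k y z ∧ h.bit x + h.bit y + h.bit z = τ

variable (s) in
/-- The transversal edges, in cyclic order. -/
def TransversalEdge (h : Halving X B) (τ : B) (u v w : X × Fin 3) : Prop :=
  v.2 = u.2 + 1 ∧ w.2 = u.2 + 2 ∧ s.Transversal h τ u.2 u.1 v.1 w.1

variable (s) in
/-- The edge relation of the `3`-graph on three levels. -/
def Edge (h : Halving X B) (D : Finset (ℕ × B)) (τ : B) (u v w : X × Fin 3) : Prop :=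
  s.MixedEdge h D u v w ∨ s.MixedEdge h D v w u ∨ s.MixedEdge h D w u v ∨
    s.TransversalEdge h τ u v w ∨ s.TransversalEdge h τ v u w

variable {τ : B}

theorem TransversalEdge.rotate {u v w : X × Fin 3} (ht : s.TransversalEdge h τ u v w) :
    s.TransversalEdge h τ v w u := by
  obtain ⟨x, i⟩ := u
  obtain ⟨y, j⟩ := v
  obtain ⟨z, l⟩ := w
  obtain ⟨h₁, h₂, k, hk, hs, hs', hb⟩ := ht
  simp only at h₁ h₂ hs hs' hb
  subst h₁ h₂
  have e : i + 1 + 1 = i + 2 := by rw [add_assoc]; rfl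
  refine ⟨e.symm, ?_, k, hk, hs', ?_, ?_⟩
  · show i = i + 1 + 2
    omega
  · show s.Step (i + 1 + 1) k z x
    rw [e]; exact hs.trans hs'
  · show h.bit y + h.bit z + h.bit x = τ
    rw [← hb]; abel

theorem Edge.swap_left (u v w : X × Fin 3) (he : s.Edge h D τ u v w) : s.Edge h D τ v u w := by
  rcases he with he | he | he | he | he
  · exact Or.inl he.symm
  · exact Or.inr (Or.inr (Or.inl he.symm))
  · exact Or.inr (Or.inl he.symm)
  · exact Or.inr (Or.inr (Or.inr (Or.inr he)))
  · exact Or.inr (Or.inr (Or.inr (Or.inl he)))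

theorem Edge.swap_right (u v w : X × Fin 3) (he : s.Edge h D τ u v w) : s.Edge h D τ u w v := by
  rcases he with he | he | he | he | he
  · exact Or.inr (Or.inr (Or.inl he.symm))
  · exact Or.inr (Or.inl he.symm)
  · exact Or.inl he.symm
  · exact Or.inr (Or.inr (Or.inr (Or.inr he.rotate.rotate)))
  · exact Or.inr (Or.inr (Or.inr (Or.inl he.rotate)))

theorem edge_same_level {i : Fin 3} {x y : X} {w : X × Fin 3} :
    s.Edge h D τ (x, i) (y, i) w ↔ w.2 = i + 1 ∧ s.Mixed h D i x y w.1 := by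
  obtain ⟨z, j⟩ := w
  constructor
  · rintro (he | he | he | he | he)
    · exact he.2
    · have := he.1; have := he.2.1; simp only at *; omega
    · have := he.1; have := he.2.1; simp only at *; omega
    · have := he.1; simp only at *; omega
    · have := he.1; simp only at *; omega
  · intro he; exact Or.inl ⟨rfl, he⟩

theorem edge_next_level {i : Fin 3} {x z : X} {w : X × Fin 3} :
    s.Edge h D τ (x, i) (z, i + 1) w ↔
      w.2 = i ∧ s.Mixed h D i w.1 x z ∨ w.2 = i + 2 ∧ s.Transversal h τ i x z w.1 := by
  obtain ⟨y, j⟩ := w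
  constructor
  · rintro (he | he | he | he | he)
    · have := he.1; simp only at *; omega
    · have := he.1; have := he.2.1; simp only at *; omega
    · obtain ⟨h₁, h₂, h₃⟩ := he
      simp only at h₁ h₂ h₃
      subst h₁
      exact Or.inl ⟨rfl, h₃⟩
    · exact Or.inr he.2
    · have := he.1; simp only at *; omega
  · rintro (⟨h₁, h₂⟩ | he)
    · simp only at h₁ h₂
      subst h₁
      exact Or.inr (Or.inr (Or.inl ⟨rfl, rfl, h₂⟩))
    · exact Or.inr (Or.inr (Or.inr (Or.inl ⟨rfl, he⟩)))

section Count

variable [Fintype X] {n : ℕ} {e : X × Fin 3 ≃ Fin n}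

/-- Bijectivity of z ↦ 2z + emb (bit z) gives one z for each index. -/
theorem pairDegree_same_level (hD : ∀ p ∈ D, p.1 < K) (i : Fin 3) {x y : X} (hxy : x ≠ y) :
    pairDegree (tripleGraph e (s.Edge h D τ)) (e (x, i)) (e (y, i)) = #D := by
  classical
  rw [pairDegree_tripleGraph Edge.swap_left Edge.swap_right (by simpa using hxy)]
  symm
  choose g hg using h.bijective.2
  simp only at hg
  refine card_bij (fun p _ => (g (x + y + (s.a i p.1 + s.a i p.1) + h.emb p.2), i + 1)) ?_ ?_ ?_
  · intro p hp
    simp only [mem_filter, mem_univ, true_and, edge_same_level]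
    refine ⟨?_, ?_, p, hp, (hg _).symm⟩ <;>
    · intro hcon
      have := congrArg Prod.snd hcon
      simp only at this
      omega
  · intro p hp r hr heq
    have h₁ := congrArg (fun w => w + w + h.emb (h.bit w)) (congrArg Prod.fst heq)
    simp only [hg] at h₁
    rw [add_assoc, add_assoc (x + y)] at h₁
    exact shift_injOn hD i hp hr (add_left_cancel h₁)
  · rintro ⟨z, j⟩ hw
    simp only [mem_filter, mem_univ, true_and, edge_same_level] at hw
    obtain ⟨-, -, rfl, p, hp, heq⟩ := hw
    refine ⟨p, hp, ?_⟩
    rw [heq, Prod.mk.injEq]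
    exact ⟨h.bijective.1 (hg _), rfl⟩

open Classical in
-- The pair determines its shift k, hence the double of the third vertex, while τ determines the
-- bit.
theorem card_transversal (i : Fin 3) (x z : X) :
    #{w | s.Transversal h τ i x z w} = if ∃ k < K, s.Step i k x z then 1 else 0 := by
  split_ifs with hk
  · obtain ⟨k, hk, hs⟩ := hk
    obtain ⟨w, hw, huniq⟩ := s.exists_step (i + 1) k h z (τ - h.bit x - h.bit z)
    rw [card_eq_one]
    refine ⟨w, ?_⟩
    ext w'
    rw [mem_filter, mem_singleton]
    constructor
    · rintro ⟨-, l, hl, hs₁, hs₂, hb⟩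
      obtain rfl := hs.unique hk hl hs₁
      exact huniq w' ⟨hs₂, by rw [← hb]; abel⟩
    · rintro rfl
      exact ⟨mem_univ _, k, hk, hs, hw.1, by rw [hw.2]; abel⟩
  · rw [card_eq_zero, filter_eq_empty_iff]
    rintro w - ⟨k, hk', hs, -⟩
    exact hk ⟨k, hk', hs⟩

open Classical in
-- The solution y = x is lost when the pair is a step with index in `D`; a transversal edge is
-- gained when it is a step at all. The net gain is a step whose index is missing from `D`.
theorem pairDegree_next_level (hD : ∀ p ∈ D, p.1 < K) (i : Fin 3) (x z : X) :
    pairDegree (tripleGraph e (s.Edge h D τ)) (e (x, i)) (e (z, i + 1)) =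
      #D + if ∃ k < K, (k, h.bit z) ∉ D ∧ s.Step i k x z then 1 else 0 := by
  have hne : ((x, i) : X × Fin 3) ≠ (z, i + 1) := by
    intro hcon
    have := congrArg Prod.snd hcon
    simp only at this
    omega
  rw [pairDegree_tripleGraph Edge.swap_left Edge.swap_right hne]
  refine (congrArg card (?_ : _ = ({y | s.Mixed h D i y x z} : Finset X).erase x ×ˢ {i} ∪
    ({w | s.Transversal h τ i x z w} : Finset X) ×ˢ {i + 2})).trans ?_
  · ext ⟨y, j⟩
    simp only [mem_filter, mem_univ, true_and, edge_next_level, mem_union, mem_product, mem_erase,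
      mem_singleton, ne_eq, Prod.mk.injEq]
    constructor
    · rintro ⟨h₁, h₂, ⟨rfl, h₃⟩ | ⟨rfl, h₃⟩⟩
      · exact Or.inl ⟨⟨fun hyx => h₁ ⟨hyx, rfl⟩, h₃⟩, rfl⟩
      · exact Or.inr ⟨h₃, rfl⟩
    · rintro (⟨⟨h₁, h₂⟩, rfl⟩ | ⟨h₁, rfl⟩)
      · refine ⟨fun hc => h₁ hc.1, fun hc => ?_, Or.inl ⟨rfl, h₂⟩⟩
        have := hc.2
        omega
      · refine ⟨fun hc => ?_, fun hc => ?_, Or.inr ⟨rfl, h₁⟩⟩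
        · have := hc.2
          omega
        · have := hc.2
          omega
  rw [card_union_of_disjoint, card_product, card_product, card_singleton, card_singleton,
    mul_one, mul_one, card_transversal]
  · have hc := card_mixed (s := s) (h := h) hD i x z
    by_cases hself : s.Mixed h D i x x z
    · have hx : x ∈ ({y | s.Mixed h D i y x z} : Finset X) := by simpa using hself
      rw [card_erase_of_mem hx, hc]
      obtain ⟨k, hk, hs⟩ := mixed_self_iff.1 hself
      have hpos : 0 < #D := card_pos.2 ⟨_, hk⟩
      rw [if_pos ⟨k, hD _ hk, hs⟩, if_neg]
      · omega
      · rintro ⟨l, hl, hlD, hs'⟩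
        obtain rfl := hs.unique (hD _ hk) hl hs'
        exact hlD hk
    · rw [erase_eq_of_notMem (by simpa using hself), hc]
      congr 1
      refine if_congr ?_ rfl rfl
      constructor
      · rintro ⟨k, hk, hs⟩
        exact ⟨k, hk, fun hkD => hself (mixed_self_iff.2 ⟨k, hkD, hs⟩), hs⟩
      · rintro ⟨k, hk, -, hs⟩
        exact ⟨k, hk, hs⟩
  · rw [disjoint_left]
    rintro ⟨y, j⟩ h₁ h₂
    simp only [mem_product, mem_singleton] at h₁ h₂
    have := h₁.2
    have := h₂.2
    omega

theorem level_cases (i j : Fin 3) : j = i ∨ j = i + 1 ∨ i = j + 1 := by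
  omega

theorem isSteinerTripleSystem_tripleGraph (hD : ∀ p ∈ D, p.1 < K)
    (hfull : ∀ k < K, ∀ b, (k, b) ∈ D) :
    IsSteinerTripleSystem (tripleGraph e (s.Edge h D τ)) #D := by
  refine ⟨isThreeGraph_tripleGraph _ _, fun u v huv => ?_⟩
  obtain ⟨⟨x, i⟩, rfl⟩ := e.surjective u
  obtain ⟨⟨y, j⟩, rfl⟩ := e.surjective v
  have hnext : ∀ i x z,
      pairDegree (tripleGraph e (s.Edge h D τ)) (e (x, i)) (e (z, i + 1)) = #D := by
    intro i x z
    rw [pairDegree_next_level hD, if_neg, add_zero]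
    rintro ⟨k, hk, hkD, -⟩
    exact hkD (hfull k hk _)
  rcases level_cases i j with rfl | rfl | rfl
  · exact pairDegree_same_level hD _ (by rintro rfl; exact huv rfl)
  · exact hnext _ _ _
  · rw [pairDegree_comm]; exact hnext _ _ _

end Count

end Shifts

end Construction

/-! ### The matching along the unused shift, and the case of one dropped index -/

section Construction
open Finset

variable {X B : Type*} [AddCommGroup X] {K : ℕ}

namespace Shifts

variable {s : Shifts X K} {h : Halving X B} {D : Finset (ℕ × B)}

section Matching

variable {n : ℕ} {e : X × Fin 3 ≃ Fin n}

theorem card_matchingTriple (x : X) : #(s.matchingTriple e x) = 3 := by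
  refine card_eq_three.2 ⟨_, _, _, ?_, ?_, ?_, rfl⟩ <;> simp [e.injective.eq_iff]

variable [Fintype X]

theorem isPerfectTripleMatching_matchingTriple :
    IsPerfectTripleMatching (univ.image (s.matchingTriple e)) := by
  refine ⟨?_, ?_, ?_⟩
  · intro E hE
    obtain ⟨x, -, rfl⟩ := mem_image.1 hE
    exact card_matchingTriple x
  · intro A hA A' hA' hne
    obtain ⟨x, -, rfl⟩ := mem_image.1 hA
    obtain ⟨x', -, rfl⟩ := mem_image.1 hA'
    rw [disjoint_left]
    intro v hv hv'
    obtain ⟨⟨y, j⟩, rfl⟩ := e.surjective v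
    rw [mem_matchingTriple] at hv hv'
    apply hne
    congr 1
    rcases hv with ⟨rfl, hv⟩ | ⟨rfl, hv⟩ | ⟨rfl, hv⟩ <;> subst hv <;> simpa using hv'
  · intro v
    obtain ⟨⟨y, j⟩, rfl⟩ := e.surjective v
    simp only [mem_image, mem_univ, true_and, exists_exists_eq_and, mem_matchingTriple]
    fin_cases j
    · exact ⟨y, by simp⟩
    · exact ⟨y - s.a 0 K, by simp⟩
    · exact ⟨y - s.a 1 K - s.a 0 K, by simp⟩

/-- Transversal edges use shifts k < K, and doubles of shifts up to K are distinct. -/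
theorem matchingTriple_subset_tripleComplement [AddCommGroup B] {τ : B} :
    univ.image (s.matchingTriple e) ⊆ tripleComplement (tripleGraph e (s.Edge h D τ)) := by
  intro E hE
  obtain ⟨x, -, rfl⟩ := mem_image.1 hE
  refine mem_sdiff.2 ⟨mem_powersetCard.2 ⟨subset_univ _, card_matchingTriple x⟩, fun hmem => ?_⟩
  rw [matchingTriple, mem_tripleGraph Edge.swap_left Edge.swap_right (by simp) (by simp) (by simp)]
    at hmem
  have := (edge_next_level (i := (0 : Fin 3))).1 hmem
  rcases this with ⟨h₁, -⟩ | ⟨-, k, hk, hs, -⟩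
  · simp at h₁
  · unfold Step at hs
    have : s.a 0 K + s.a 0 K = s.a 0 k + s.a 0 k := by
      refine add_left_cancel (a := x + x) ?_
      rw [← hs]; abel
    have := s.inj 0 _ _ le_rfl hk.le this
    omega

end Matching

section Excess

/-- The shifts with both bits, except the last shift with bit `1`. -/
def truncatedIndices (K : ℕ) : Finset (ℕ × ZMod 2) :=
  (range (K + 1) ×ˢ univ).erase (K, 1)

theorem card_truncatedIndices (K : ℕ) : #(truncatedIndices K) = 2 * K + 1 := by
  rw [truncatedIndices, card_erase_of_mem (by simp), card_product, card_range, card_univ,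
    ZMod.card]
  omega

theorem lt_of_mem_truncatedIndices {K : ℕ} : ∀ p ∈ truncatedIndices K, p.1 < K + 1 := by
  intro p hp
  exact mem_range.1 (mem_product.1 (mem_of_mem_erase hp)).1

variable (s : Shifts X (K + 1)) (h : Halving X (ZMod 2))

/-- The pairs that lie in one edge more than the others, directed to the next level. -/
def Excess (u v : X × Fin 3) : Prop :=
  v.2 = u.2 + 1 ∧ h.bit v.1 = 1 ∧ s.Step u.2 K u.1 v.1

variable {s h}

theorem exists_truncated_iff {i : Fin 3} {x z : X} :
    (∃ k < K + 1, (k, h.bit z) ∉ truncatedIndices K ∧ s.Step i k x z) ↔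
      s.Excess h (x, i) (z, i + 1) := by
  constructor
  · rintro ⟨k, hk, hkD, hs⟩
    simp only [truncatedIndices, mem_erase, mem_product, mem_range, mem_univ, hk, and_true,
      ne_eq, not_not, Prod.mk.injEq] at hkD
    exact ⟨rfl, hkD.2, hkD.1 ▸ hs⟩
  · rintro ⟨-, hb, hs⟩
    exact ⟨K, K.lt_succ_self, by simp_all [truncatedIndices], hs⟩

theorem Excess.not_same_level {i : Fin 3} {x y : X} : ¬ s.Excess h (x, i) (y, i) := by
  rintro ⟨h₁, -⟩
  simp only at h₁
  omega

theorem Excess.not_reverse {u v : X × Fin 3} (he : s.Excess h u v) : ¬ s.Excess h v u := by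
  rintro ⟨h₁, -⟩
  have := he.1
  omega

theorem Excess.existsUnique (u : X × Fin 3) : ∃! v, s.Excess h u v := by
  obtain ⟨z, hz, huniq⟩ := s.exists_step u.2 K h u.1 1
  refine ⟨(z, u.2 + 1), ⟨rfl, hz.2, hz.1⟩, ?_⟩
  rintro ⟨w, j⟩ ⟨h₁, h₂, h₃⟩
  exact Prod.ext (huniq w ⟨h₃, h₂⟩) h₁

/-- Predecessors of v share their double, so there are at most two, one for each bit. -/
theorem Excess.left_unique {u u' v : X × Fin 3} (he : s.Excess h u v) (he' : s.Excess h u' v)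
    (hb : h.bit u.1 = h.bit u'.1) : u = u' := by
  have hj : u.2 = u'.2 := by
    have := he.1
    have := he'.1
    omega
  obtain ⟨z, hz, huniq⟩ := s.exists_step_left u.2 K h v.1 (h.bit u.1)
  refine Prod.ext ?_ hj
  rw [huniq u.1 ⟨he.2.2, rfl⟩, huniq u'.1 ⟨hj ▸ he'.2.2, hb.symm⟩]

/-- The targets x and v have bit 1, so the bits sum to 1 + 1 + 1 = 1; this is why τ = 1. -/
theorem Excess.edge {D : Finset (ℕ × ZMod 2)} {x v p : X × Fin 3} (hv : s.Excess h x v)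
    (hp : s.Excess h p x) (hb : h.bit p.1 = 1) : s.Edge h D 1 x v p := by
  obtain ⟨x, i⟩ := x
  obtain ⟨v, j⟩ := v
  obtain ⟨p, l⟩ := p
  obtain ⟨h₁, h₂, h₃⟩ := hv
  obtain ⟨h₄, h₅, h₆⟩ := hp
  simp only at h₁ h₂ h₃ h₄ h₅ h₆ hb
  subst h₁ h₄
  refine Or.inr (Or.inr (Or.inr (Or.inl ⟨rfl, ?_, K, K.lt_succ_self, h₃, ?_, ?_⟩)))
  · show l = l + 1 + 2
    omega
  · have := h₆.trans h₃
    show s.Step (l + 1 + 1) K v p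
    rwa [add_assoc]
  · show h.bit x + h.bit v + h.bit p = 1
    rw [h₅, h₂, hb]
    decide

/-- With one successor and at most two predecessors, three neighbours include predecessors of both
bits; the one of bit 1 forms an edge with x and the successor. -/
theorem Excess.exists_edge {D : Finset (ℕ × ZMod 2)} {x a b c : X × Fin 3} (hab : a ≠ b)
    (hac : a ≠ c) (hbc : b ≠ c) (ha : s.Excess h x a ∨ s.Excess h a x)
    (hb : s.Excess h x b ∨ s.Excess h b x) (hc : s.Excess h x c ∨ s.Excess h c x) :
    s.Edge h D 1 x a b ∨ s.Edge h D 1 x a c ∨ s.Edge h D 1 x b c := by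
  have hbit : ∀ t : ZMod 2, t = 0 ∨ t = 1 := by decide
  have hsucc : ∀ {t t'}, t ≠ t' → s.Excess h x t → ¬ s.Excess h x t' := fun hne h₁ h₂ =>
    hne ((Excess.existsUnique x).unique h₁ h₂)
  have key : ∀ {t p}, s.Excess h x t → s.Excess h p x → h.bit p.1 = 1 →
      s.Edge h D 1 x t p ∧ s.Edge h D 1 x p t := fun h₁ h₂ h₃ =>
    ⟨h₁.edge h₂ h₃, Edge.swap_right _ _ _ (h₁.edge h₂ h₃)⟩
  have hone : ∀ {t t' r}, s.Excess h x r → t ≠ t' → s.Excess h t x → s.Excess h t' x →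
      (s.Edge h D 1 x r t ∧ s.Edge h D 1 x t r) ∨ (s.Edge h D 1 x r t' ∧ s.Edge h D 1 x t' r) := by
    intro t t' r hr hne h₁ h₂
    by_cases h₃ : h.bit t.1 = 1
    · exact Or.inl (key hr h₁ h₃)
    · by_cases h₄ : h.bit t'.1 = 1
      · exact Or.inr (key hr h₂ h₄)
      · exact absurd (h₁.left_unique h₂ (((hbit _).resolve_right h₃).trans
          ((hbit _).resolve_right h₄).symm)) hne
  rcases ha with ha | ha <;> rcases hb with hb | hb <;> rcases hc with hc | hc
  · exact absurd hb (hsucc hab ha)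
  · exact absurd hb (hsucc hab ha)
  · exact absurd hc (hsucc hac ha)
  · have := hone ha hbc hb hc
    tauto
  · exact absurd hc (hsucc hbc hb)
  · have := hone hb hac ha hc
    tauto
  · have := hone hc hab ha hb
    tauto
  · exfalso
    have hthree : ∀ r t q : ZMod 2, r = t ∨ r = q ∨ t = q := by decide
    rcases hthree (h.bit a.1) (h.bit b.1) (h.bit c.1) with h₁ | h₁ | h₁
    · exact hab (ha.left_unique hb h₁)
    · exact hac (ha.left_unique hc h₁)
    · exact hbc (hb.left_unique hc h₁)

variable [Fintype X] {n : ℕ} {e : X × Fin 3 ≃ Fin n}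

open Classical in
theorem pairDegree_truncated {u v : X × Fin 3} (huv : u ≠ v) :
    pairDegree (tripleGraph e (s.Edge h (truncatedIndices K) 1)) (e u) (e v) =
      2 * K + 1 + ((if s.Excess h u v then 1 else 0) + if s.Excess h v u then 1 else 0) := by
  obtain ⟨x, i⟩ := u
  obtain ⟨y, j⟩ := v
  have hback : ∀ i x z, ¬ s.Excess h (z, i + 1) (x, i) := by
    rintro i x z ⟨h₁, -⟩
    simp only at h₁
    omega
  rcases level_cases i j with rfl | rfl | rfl
  · rw [pairDegree_same_level lt_of_mem_truncatedIndices _ (by rintro rfl; exact huv rfl),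
      if_neg Excess.not_same_level, if_neg Excess.not_same_level, card_truncatedIndices]
  · rw [pairDegree_next_level lt_of_mem_truncatedIndices, card_truncatedIndices]
    simp only [exists_truncated_iff]
    split_ifs with h₁ h₂
    · exact absurd h₂ h₁.not_reverse
    · rfl
    · exact absurd ‹_› (hback i x y)
    · rfl
  · rw [pairDegree_comm, pairDegree_next_level lt_of_mem_truncatedIndices, card_truncatedIndices]
    simp only [exists_truncated_iff]
    split_ifs with h₁ h₂
    · exact absurd h₂ h₁.not_reverse
    · rfl
    · exact absurd ‹_› (hback j y x)
    · rfl

theorem noNontrivialIntersectingSubgraph_truncated (hK : 1 ≤ K) :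
    NoNontrivialIntersectingSubgraph (tripleGraph e (s.Edge h (truncatedIndices K) 1))
      (3 * (2 * K + 2) + 1) := by
  classical
  refine noNontrivialIntersectingSubgraph_of_pairDegree (by omega)
    (isThreeGraph_tripleGraph _ _) ?_ ?_
  · intro u v huv
    obtain ⟨u, rfl⟩ := e.surjective u
    obtain ⟨v, rfl⟩ := e.surjective v
    rw [pairDegree_truncated (by rintro rfl; exact huv rfl)]
    by_cases h₁ : s.Excess h u v
    · rw [if_pos h₁, if_neg h₁.not_reverse]
    · rw [if_neg h₁]; split_ifs <;> omega
  · intro x a b c hxa hxb hxc hab hac hbc ha hb hc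
    obtain ⟨x, rfl⟩ := e.surjective x
    obtain ⟨a, rfl⟩ := e.surjective a
    obtain ⟨b, rfl⟩ := e.surjective b
    obtain ⟨c, rfl⟩ := e.surjective c
    rw [e.injective.ne_iff] at *
    rw [mem_tripleGraph Edge.swap_left Edge.swap_right hxa hxb hab,
      mem_tripleGraph Edge.swap_left Edge.swap_right hxa hxc hac,
      mem_tripleGraph Edge.swap_left Edge.swap_right hxb hxc hbc]
    have key : ∀ t, x ≠ t →
        pairDegree (tripleGraph e (s.Edge h (truncatedIndices K) 1)) (e x) (e t) = 2 * K + 2 →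
        s.Excess h x t ∨ s.Excess h t x := by
      intro t hxt ht
      rw [pairDegree_truncated hxt] at ht
      by_contra hcon
      rw [not_or] at hcon
      rw [if_neg hcon.1, if_neg hcon.2] at ht
      omega
    exact Excess.exists_edge hab hac hbc (key a hxa ha) (key b hxb hb) (key c hxc hc)

/-- Each vertex has exactly one successor, so `Excess` and its reverse contribute n ordered pairs
each. -/
theorem card_truncated :
    ((#(tripleGraph e (s.Edge h (truncatedIndices K) 1)) : ℕ) : ℚ) =
      (((2 * K + 2 : ℕ) : ℚ) - 1) / 3 * (n.choose 2 : ℚ) + (n : ℚ) / 3 := by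
  classical
  refine card_eq_of_sum_pairDegree (by omega) (isThreeGraph_tripleGraph _ _) ?_
  have hdeg : ∀ p ∈ (univ : Finset (Fin n)).offDiag,
      pairDegree (tripleGraph e (s.Edge h (truncatedIndices K) 1)) p.1 p.2 =
        2 * K + 1 + ((if s.Excess h (e.symm p.1) (e.symm p.2) then 1 else 0) +
          if s.Excess h (e.symm p.2) (e.symm p.1) then 1 else 0) := by
    intro p hp
    rw [← pairDegree_truncated (e := e) (e.symm.injective.ne (mem_offDiag.1 hp).2.2),
      e.apply_symm_apply, e.apply_symm_apply]
  choose f hf hfu using Excess.existsUnique (s := s) (h := h)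
  have hne : ∀ u, u ≠ f u := by
    intro u hu
    have := (hf u).1
    rw [← hu] at this
    omega
  have h₁ : #{p ∈ (univ : Finset (Fin n)).offDiag | s.Excess h (e.symm p.1) (e.symm p.2)} = n := by
    have : {p ∈ (univ : Finset (Fin n)).offDiag | s.Excess h (e.symm p.1) (e.symm p.2)} =
        univ.image fun u => (u, e (f (e.symm u))) := by
      ext ⟨u, v⟩
      simp only [mem_filter, mem_offDiag, mem_univ, true_and, mem_image, Prod.mk.injEq,
        exists_eq_left]
      constructor
      · rintro ⟨-, he⟩
        rw [← hfu _ _ he, e.apply_symm_apply]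
      · rintro rfl
        refine ⟨fun hcon => hne (e.symm u) ?_, ?_⟩
        · conv_lhs => rw [hcon]
          rw [e.symm_apply_apply]
        · rw [e.symm_apply_apply]; exact hf _
    rw [this, card_image_of_injective _ fun u v huv => congrArg Prod.fst huv, card_univ,
      Fintype.card_fin]
  have h₂ : #{p ∈ (univ : Finset (Fin n)).offDiag | s.Excess h (e.symm p.2) (e.symm p.1)} = n := by
    conv_rhs => rw [← h₁]
    refine card_bij (fun p _ => p.swap) ?_ (fun p _ r _ => Prod.swap_injective.eq_iff.1) ?_
    · intro p hp
      simp only [mem_filter, mem_offDiag, mem_univ, true_and] at hp ⊢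
      exact ⟨hp.1.symm, hp.2⟩
    · intro p hp
      simp only [mem_filter, mem_offDiag, mem_univ, true_and] at hp
      exact ⟨p.swap, by simpa using ⟨hp.1.symm, hp.2⟩, rfl⟩
  rw [sum_congr rfl hdeg, sum_add_distrib, sum_add_distrib (f := fun p : Fin n × Fin n =>
    if s.Excess h (e.symm p.1) (e.symm p.2) then 1 else 0), ← card_filter, ← card_filter, h₁, h₂,
    sum_const, smul_eq_mul]
  rw [show 2 * K + 2 - 1 = 2 * K + 1 by omega]
  ring

end Excess

end Shifts

end Construction

/-! ### Cyclic groups and the parity cases -/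

section Instances
open Finset

/-- Doubling is bijective in odd cyclic groups. -/
def Halving.ofOdd {q : ℕ} (hq : Odd q) : Halving (ZMod q) Unit where
  bit _ := ()
  emb _ := 0
  bijective := by
    obtain ⟨j, rfl⟩ := hq
    have hone : ((j : ZMod (2 * j + 1)) + j + 1) = 0 := by
      have := ZMod.natCast_self (2 * j + 1)
      push_cast at this
      rw [← this]; ring
    -- Modulo 2j + 1 the inverse of 2 is j + 1.
    refine Function.bijective_iff_has_inverse.2 ⟨fun z => z * (j + 1), fun z => ?_, fun z => ?_⟩
    · show (z + z + 0) * ((j : ZMod (2 * j + 1)) + 1) = z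
      linear_combination z * hone
    · show z * ((j : ZMod (2 * j + 1)) + 1) + z * (j + 1) + 0 = z
      linear_combination z * hone
  sep _ _ _ _ _ := rfl

/-- Reduction modulo 2 kills the doubles and leaves the bits. -/
theorem ZMod.even_sep {r : ℕ} {u v : ZMod (2 * r)} {b c : ZMod 2}
    (h : u + u + (b.val : ZMod (2 * r)) = v + v + (c.val : ZMod (2 * r))) : b = c := by
  have h' := congrArg (ZMod.castHom (dvd_mul_right 2 r) (ZMod 2)) h
  have hdouble : ∀ t : ZMod 2, t + t = 0 := by decide
  simpa only [map_add, map_natCast, hdouble, zero_add, ZMod.natCast_zmod_val] using h'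

/-- In cyclic groups of even order, the bit of an element tells the half in which it lies. -/
def Halving.ofEven (r : ℕ) [NeZero r] : Halving (ZMod (2 * r)) (ZMod 2) where
  bit z := if z.val < r then 0 else 1
  emb b := (b.val : ZMod (2 * r))
  bijective := by
    have hr : 0 < r := NeZero.pos r
    have : NeZero (2 * r) := ⟨by omega⟩
    refine Finite.injective_iff_bijective.1 fun z w hzw => ?_
    have hb := ZMod.even_sep hzw
    beta_reduce at hzw
    rw [hb] at hzw
    have h2 := add_right_cancel hzw
    have hz := ZMod.val_lt z
    have hw := ZMod.val_lt w
    rw [← ZMod.natCast_zmod_val z, ← ZMod.natCast_zmod_val w, ← Nat.cast_add, ← Nat.cast_add,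
      ZMod.natCast_eq_natCast_iff, ← two_mul, ← two_mul] at h2
    -- Equal doubles mean congruence modulo r, and equal bits put both in the same half.
    have h3 : z.val ≡ w.val [MOD r] := Nat.ModEq.mul_left_cancel' (by norm_num) h2
    refine ZMod.val_injective _ ?_
    by_cases hz' : z.val < r <;> by_cases hw' : w.val < r
    · exact Nat.ModEq.eq_of_lt_of_lt h3 hz' hw'
    · simp [hz', hw'] at hb
    · simp [hz', hw'] at hb
    · have h4 : z.val - r ≡ w.val - r [MOD r] := by
        refine Nat.ModEq.add_right_cancel' r ?_
        rwa [Nat.sub_add_cancel (by omega), Nat.sub_add_cancel (by omega)]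
      have := Nat.ModEq.eq_of_lt_of_lt h4 (by omega) (by omega)
      omega
  sep _ _ _ _ := ZMod.even_sep

theorem ZMod.natCast_inj_of_lt {q k l : ℕ} (hk : k < q) (hl : l < q)
    (h : (k : ZMod q) = l) : k = l :=
  Nat.ModEq.eq_of_lt_of_lt ((ZMod.natCast_eq_natCast_iff _ _ _).1 h) hk hl

/-- The shifts `k`, `k` and `-2 k`. -/
def Shifts.cyclic {q K : ℕ} (hq : 4 * K < q) : Shifts (ZMod q) K where
  a i k := if i = 2 then -(k + k) else k
  sum_eq_zero i k := by fin_cases i <;> simp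
  inj i k l hk hl h := by
    by_cases hi : i = 2
    · simp only [hi, if_true] at h
      -- The shift -2k has double -4k, whence the bound 4K < q.
      have := ZMod.natCast_inj_of_lt (q := q) (k := 4 * k) (l := 4 * l) (by omega) (by omega) (by
        push_cast
        linear_combination -h)
      omega
    · simp only [hi, if_false] at h
      have := ZMod.natCast_inj_of_lt (q := q) (k := 2 * k) (l := 2 * l) (by omega) (by omega) (by
        push_cast
        linear_combination h)
      omega

/-- Three copies of a cyclic group, as vertex set. -/
noncomputable def levelsEquiv (q : ℕ) [NeZero q] : ZMod q × Fin 3 ≃ Fin (3 * q) :=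
  Fintype.equivFinOfCardEq (by simp [ZMod.card, mul_comm])

/-- For q odd the bit is trivial and m - 1 shifts serve; for q even each shift carries two bits, so
m - 1 = 2K. -/
theorem exists_steiner_and_matching {q m : ℕ} (hm : 1 ≤ m) (hq : 4 * m < q)
    (hodd : Odd m ∨ Odd (3 * q)) :
    ∃ S M : Finset (Finset (Fin (3 * q))), IsSteinerTripleSystem S (m - 1) ∧
      IsPerfectTripleMatching M ∧ M ⊆ tripleComplement S := by
  have : NeZero q := ⟨by omega⟩
  rcases Nat.even_or_odd q with he | ho
  · have hmo : Odd m := by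
      refine hodd.resolve_right fun h => ?_
      rw [Nat.odd_mul] at h
      exact Nat.not_even_iff_odd.2 h.2 he
    obtain ⟨K, rfl⟩ := hmo
    obtain ⟨r, rfl⟩ := he
    rw [← two_mul] at *
    have : NeZero r := ⟨by omega⟩
    let s : Shifts (ZMod (2 * r)) K := Shifts.cyclic (by omega)
    refine ⟨_, _, ?_, Shifts.isPerfectTripleMatching_matchingTriple (s := s)
      (e := levelsEquiv (2 * r)), Shifts.matchingTriple_subset_tripleComplement
      (h := Halving.ofEven r) (D := range K ×ˢ univ) (τ := 1)⟩
    have := Shifts.isSteinerTripleSystem_tripleGraph (s := s) (h := Halving.ofEven r)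
      (D := range K ×ˢ univ) (τ := 1) (e := levelsEquiv (2 * r))
      (fun p hp => mem_range.1 (mem_product.1 hp).1) (fun k hk b => by simpa using hk)
    rwa [card_product, card_range, card_univ, ZMod.card, mul_comm K] at this
  · let s : Shifts (ZMod q) (m - 1) := Shifts.cyclic (by omega)
    refine ⟨_, _, ?_, Shifts.isPerfectTripleMatching_matchingTriple (s := s)
      (e := levelsEquiv q), Shifts.matchingTriple_subset_tripleComplement
      (h := Halving.ofOdd ho) (D := range (m - 1) ×ˢ univ) (τ := 0)⟩
    have := Shifts.isSteinerTripleSystem_tripleGraph (s := s) (h := Halving.ofOdd ho)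
      (D := range (m - 1) ×ˢ univ) (τ := 0) (e := levelsEquiv q)
      (fun p hp => mem_range.1 (mem_product.1 hp).1) (fun k hk b => by simpa using hk)
    rwa [card_product, card_range, card_univ, Fintype.card_unit, mul_one] at this

theorem exists_threeGraph_of_even {q m : ℕ} (hm : 4 ≤ m) (hq : 4 * m < q) (hme : Even m)
    (hqe : Even q) :
    ∃ H : Finset (Finset (Fin (3 * q))), IsThreeGraph H ∧
      (#H : ℚ) = ((m : ℚ) - 1) / 3 * ((3 * q).choose 2 : ℚ) + ((3 * q : ℕ) : ℚ) / 3 ∧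
      NoNontrivialIntersectingSubgraph H (3 * m + 1) := by
  obtain ⟨r, rfl⟩ := hqe
  obtain ⟨j, rfl⟩ := hme
  obtain ⟨K, rfl⟩ : ∃ K, j = K + 1 := ⟨j - 1, by omega⟩
  rw [← two_mul, ← two_mul] at *
  have : NeZero r := ⟨by omega⟩
  have : NeZero (2 * r) := ⟨by omega⟩
  let s : Shifts (ZMod (2 * r)) (K + 1) := Shifts.cyclic (by omega)
  refine ⟨tripleGraph (levelsEquiv (2 * r))
    (s.Edge (Halving.ofEven r) (Shifts.truncatedIndices K) 1), isThreeGraph_tripleGraph _ _, ?_, ?_⟩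
  · exact Shifts.card_truncated
  · exact Shifts.noNontrivialIntersectingSubgraph_truncated (by omega)

theorem exists_threeGraph {q m : ℕ} (hm : 4 ≤ m) (hq : 4 * m < q) :
    ∃ H : Finset (Finset (Fin (3 * q))), IsThreeGraph H ∧
      (#H : ℚ) = ((m : ℚ) - 1) / 3 * ((3 * q).choose 2 : ℚ) + ((3 * q : ℕ) : ℚ) / 3 ∧
      NoNontrivialIntersectingSubgraph H (3 * m + 1) := by
  by_cases hodd : Odd m ∨ Odd (3 * q)
  · obtain ⟨S, M, hS, hM, hMS⟩ := exists_steiner_and_matching (by omega) hq hodd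
    exact ⟨S ∪ M, steiner_union_matching hm _ S M hS hM hMS⟩
  · rw [not_or, Nat.not_odd_iff_even, Nat.not_odd_iff_even] at hodd
    refine exists_threeGraph_of_even hm hq hodd.1 ?_
    exact (Nat.even_mul.1 hodd.2).resolve_left (by decide)

theorem not_mubayiVerstraeteConjecture {m : ℕ} (hm : 4 ≤ m) : ¬ MubayiVerstraeteConjecture m := by
  rintro ⟨N, hN⟩
  obtain ⟨H, h3, hcard, hno⟩ := exists_threeGraph (q := N + 4 * m + 1) hm (by omega)
  have h := (hN _ (by omega) H h3 hno).1
  rw [hcard] at h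
  have : (0 : ℚ) < ((3 * (N + 4 * m + 1) : ℕ) : ℚ) / 3 := by positivity
  linarith

end Instances

theorem theorem1p7 (m : ℕ) (hm : 4 ≤ m) :
    -- existence for all large multiples of three
    (∃ N : ℕ, ∀ n : ℕ, N ≤ n → 3 ∣ n →
      (∃ H : Finset (Finset (Fin n)), IsThreeGraph H ∧
        (H.card : ℚ) = ((m : ℚ) - 1) / 3 * (n.choose 2 : ℚ) + (n : ℚ) / 3 ∧
        NoNontrivialIntersectingSubgraph H (3 * m + 1)) ∧
      -- the ingredients of the construction exist whenever parity permits
      (Odd m ∨ Odd n → ∃ S M : Finset (Finset (Fin n)),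
        IsSteinerTripleSystem S (m - 1) ∧ IsPerfectTripleMatching M ∧
          M ⊆ tripleComplement S)) ∧
    -- every Steiner system together with a perfect matching of its complement is an example
    (∀ (n : ℕ) (S M : Finset (Finset (Fin n))),
      IsSteinerTripleSystem S (m - 1) → IsPerfectTripleMatching M → M ⊆ tripleComplement S →
        IsThreeGraph (S ∪ M) ∧
        ((S ∪ M).card : ℚ) = ((m : ℚ) - 1) / 3 * (n.choose 2 : ℚ) + (n : ℚ) / 3 ∧
        NoNontrivialIntersectingSubgraph (S ∪ M) (3 * m + 1)) ∧
    ¬ MubayiVerstraeteConjecture m := by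
  -- For n = 3q this gives 4m < q, enough room for shifts with distinct doubles.
  refine ⟨⟨3 * (4 * m + 1), fun n hn h3 => ?_⟩, steiner_union_matching hm,
    not_mubayiVerstraeteConjecture hm⟩
  obtain ⟨q, rfl⟩ := h3
  exact ⟨exists_threeGraph hm (by omega), exists_steiner_and_matching (by omega) (by omega)⟩
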